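/- **Conventions.** Let $n\ge 1$ be an integer and let $\mathscr M(\mathbb R^n)$ be the set of (real- or complex-valued) Lebesgue measurable functions on $\mathbb R^n$. A *ball Banach function space* $X$ is a Banach space $X=\{f\in\mathscr M(\mathbb R^n):\|f\|_X<\infty\}$ whose norm $\|\cdot\|_X$ is defined on $\mathscr M(\mathbb R^n)$ with values in $[0,\infty]$ and satisfies: (a) $\|f\|_X=0$ implies $f=0$ a.e.; (b) $|g|\le|f|$ a.e. implies $\|g\|_X\le\|f\|_X$; (c) $0\le f_m\uparrow f$ a.e. implies $\|f_m\|_X\uparrow\|f\|_X$; (d) $\mathbf 1_B\in X$ for every ball $B$; (e) for every ball $B$ there is a constant $C_{(B)}$ with $\int_B|f|\,dx\le C_{(B)}\|f\|_X$ for all $f\in X$. For $p\in(0,\infty)$, $X^{1/p}$ is the space with $\|f\|_{X^{1/p}}:=\|\,|f|^{1/p}\|_X^{p}$, and the associate space $Y'$ of a ball Banach function space $Y$ has the norm $\|f\|_{Y'}:=\sup\{\|fg\|_{L^1(\mathbb R^n)}:\ \|g\|_Y=1\}$. The Hardy--Littlewood maximal operator is $\mathcal M(f)(x):=\sup_{B\ni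 x}\frac1{|B|}\int_B|f(y)|\,dy$, the supremum being over all balls $B$ containing $x$; it is bounded on a space $Z$ if $\|\mathcal M(f)\|_Z\le C\|f\|_Z$ for all $f\in Z$, with $C$ independent of $f$. For $q\in(0,\infty)$ let $\kappa(q,n):=\int_{\mathbb S^{n-1}}|e\cdot\omega|^q\,d\omega$, where $e$ is any unit vector of $\mathbb R^n$. For $f:\mathbb R^n\to\mathbb R$, $\lambda\in(0,\infty)$ and $b\in\mathbb R$ let $$E_{\lambda,b}[f]:=\left\{(x,y)\in\mathbb R^n\times\mathbb R^n:\ x\ne y,\ \frac{|f(x)-f(y)|}{|x-y|^{1+b}}>\lambda\right\},$$ and, for $\gamma\in\mathbb R\setminus\{0\}$, let $$\Phi_{\gamma,q}(f,\lambda):=\lambda\left\|\left[\int_{\mathbb R^n}\mathbf 1_{E_{\lambda,\gamma/q}[f]}(\cdot,y)\,|\cdot-y|^{\gamma-n}\,dy\right]^{1/q}\right\|_X .$$ **Statement.** Let $X$ be a ball Banach function space on $\mathbb R^n$; the functions $f$ below are real-valued. (i) If $\gamma,q\in(0,\infty)$, then, for any $f\in C^1(\mathbb R^n)$ with $|\nabla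 f|\in C_{\mathrm c}(\mathbb R^n)$, $$\lim_{\lambda\to\infty}\Phi_{\gamma,q}(f,\lambda)=\left[\frac{\kappa(q,n)}{\gamma}\right]^{1/q}\|\,|\nabla f|\,\|_X .$$ (ii) Let $p\in[1,\infty)$, $\gamma\in(-\infty,0)$ and $q\in(0,\frac{n-\gamma}{n}p)$. Assume that $X^{1/p}$ is a ball Banach function space and that the Hardy--Littlewood maximal operator is bounded on $(X^{1/p})'$. Then, for any $f\in C^1_{\mathrm c}(\mathbb R^n)$, $$\lim_{\lambda\to0^+}\Phi_{\gamma,q}(f,\lambda)=\left[-\frac{\kappa(q,n)}{\gamma}\right]^{1/q}\|\,|\nabla f|\,\|_X ;$$ moreover, if $n\ge2$, or if both $n=1$ and $q\in(0,-p\gamma)$, then this identity also holds for any $f\in C^1(\mathbb R^n)$ with $|\nabla f|\in C_{\mathrm c}(\mathbb R^n)$. -/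

import Mathlib

open MeasureTheory Filter Topology Set
open scoped ENNReal NNReal

/-- A norm functional `N : (ℝⁿ → 𝕜) → [0, ∞]` (used on Lebesgue measurable functions only)
defines the ball Banach function space `X = {f measurable : N f < ∞}`, `‖f‖_X = N f`.
Completeness of `X` is a consequence of these properties (Riesz–Fischer), so it is not a field. -/
structure IsBallBanachFunctionSpace {𝕜 : Type*} [RCLike 𝕜] {n : ℕ}
    (N : (EuclideanSpace ℝ (Fin n) → 𝕜) → ℝ≥0∞) : Prop where
  /-- absolute homogeneity -/
  smul : ∀ (c : 𝕜) (f : EuclideanSpace ℝ (Fin n) → 𝕜), AEMeasurable f volume →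
    N (fun x => c * f x) = ‖c‖ₑ * N f
  /-- triangle inequality -/
  add_le : ∀ f g : EuclideanSpace ℝ (Fin n) → 𝕜, AEMeasurable f volume → AEMeasurable g volume →
    N (fun x => f x + g x) ≤ N f + N g
  /-- definiteness -/
  eq_zero : ∀ f : EuclideanSpace ℝ (Fin n) → 𝕜, AEMeasurable f volume → N f = 0 →
    ∀ᵐ x ∂volume, f x = 0
  /-- lattice property -/
  mono : ∀ f g : EuclideanSpace ℝ (Fin n) → 𝕜, AEMeasurable f volume → AEMeasurable g volume →
    (∀ᵐ x ∂volume, ‖g x‖ ≤ ‖f x‖) → N g ≤ N f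
  /-- Fatou property: `0 ≤ F m ↑ f` almost everywhere implies `‖F m‖ ↑ ‖f‖` -/
  fatou : ∀ (F : ℕ → EuclideanSpace ℝ (Fin n) → ℝ) (f : EuclideanSpace ℝ (Fin n) → ℝ),
    (∀ m, AEMeasurable (F m) volume) → AEMeasurable f volume →
    (∀ᵐ x ∂volume, (∀ m, 0 ≤ F m x) ∧ Monotone (fun m => F m x) ∧
      Tendsto (fun m => F m x) atTop (𝓝 (f x))) →
    Tendsto (fun m => N (fun x => ((F m x : ℝ) : 𝕜))) atTop (𝓝 (N (fun x => ((f x : ℝ) : 𝕜))))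
  /-- indicators of balls belong to `X` -/
  ball_lt_top : ∀ (c : EuclideanSpace ℝ (Fin n)) (r : ℝ), 0 < r →
    N ((Metric.ball c r).indicator (fun _ => (1 : 𝕜))) < ∞
  /-- `X` embeds into `L¹(B)` for every ball `B` -/
  lintegral_ball_le : ∀ (c : EuclideanSpace ℝ (Fin n)) (r : ℝ), 0 < r → ∃ C : ℝ≥0,
    ∀ f : EuclideanSpace ℝ (Fin n) → 𝕜, AEMeasurable f volume → N f < ∞ →
      ∫⁻ x in Metric.ball c r, ‖f x‖ₑ ≤ C * N f

/-- The value of a norm functional at a `[0, ∞]`-valued function: a function which is infinite on a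
set of positive measure has norm `∞`. -/
noncomputable def extNorm {𝕜 : Type*} [RCLike 𝕜] {n : ℕ}
    (N : (EuclideanSpace ℝ (Fin n) → 𝕜) → ℝ≥0∞) (h : EuclideanSpace ℝ (Fin n) → ℝ≥0∞) : ℝ≥0∞ :=
  open Classical in
  if ∀ᵐ x ∂volume, h x ≠ ∞ then N (fun x => (((h x).toReal : ℝ) : 𝕜)) else ∞

/-- The norm of the `s`-convexification `X^s`, namely `‖f‖_{X^s} = ‖ |f|^s ‖_X^{1/s}`. -/
noncomputable def convexificationNorm {𝕜 : Type*} [RCLike 𝕜] {n : ℕ}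
    (N : (EuclideanSpace ℝ (Fin n) → 𝕜) → ℝ≥0∞) (s : ℝ) (f : EuclideanSpace ℝ (Fin n) → 𝕜) :
    ℝ≥0∞ :=
  (N (fun x => ((‖f x‖ ^ s : ℝ) : 𝕜))) ^ (1 / s)

/-- The norm of the associate space (Köthe dual) `X'`. -/
noncomputable def associateNorm {𝕜 : Type*} [RCLike 𝕜] {n : ℕ}
    (N : (EuclideanSpace ℝ (Fin n) → 𝕜) → ℝ≥0∞) (f : EuclideanSpace ℝ (Fin n) → 𝕜) : ℝ≥0∞ :=
  ⨆ (g : EuclideanSpace ℝ (Fin n) → 𝕜) (_ : AEMeasurable g volume ∧ N g = 1),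
    ∫⁻ x, ‖f x * g x‖ₑ

/-- The (uncentred) Hardy–Littlewood maximal function. -/
noncomputable def hlMaximal {𝕜 : Type*} [RCLike 𝕜] {n : ℕ} (f : EuclideanSpace ℝ (Fin n) → 𝕜)
    (x : EuclideanSpace ℝ (Fin n)) : ℝ≥0∞ :=
  ⨆ (c : EuclideanSpace ℝ (Fin n)) (r : ℝ) (_ : 0 < r ∧ x ∈ Metric.ball c r),
    (∫⁻ y in Metric.ball c r, ‖f y‖ₑ) / volume (Metric.ball c r)

/-- The Hardy–Littlewood maximal operator is bounded on the space with norm functional `N`. -/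
def HLMaximalBoundedOn {𝕜 : Type*} [RCLike 𝕜] {n : ℕ}
    (N : (EuclideanSpace ℝ (Fin n) → 𝕜) → ℝ≥0∞) : Prop :=
  ∃ C : ℝ≥0, ∀ f : EuclideanSpace ℝ (Fin n) → 𝕜, AEMeasurable f volume → N f < ∞ →
    extNorm N (hlMaximal f) ≤ C * N f

/-- `∫_{S^{n-1}} |e · ω|^q dω`, with respect to surface measure on the unit sphere. For unit
vectors `e` the value does not depend on `e`, and is `κ(q, n)`. -/
noncomputable def kappa {n : ℕ} (q : ℝ) (e : EuclideanSpace ℝ (Fin n)) : ℝ :=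
  ∫ ω : Metric.sphere (0 : EuclideanSpace ℝ (Fin n)) 1,
    |inner ℝ e (ω : EuclideanSpace ℝ (Fin n))| ^ q
      ∂(volume : Measure (EuclideanSpace ℝ (Fin n))).toSphere

/-- The set `E_{l, b}[f]` of all `(x, y)` with `x ≠ y` and `|f x - f y| / |x - y|^{1+b} > l`. -/
def levelSet {n : ℕ} (l b : ℝ) (f : EuclideanSpace ℝ (Fin n) → ℝ) :
    Set (EuclideanSpace ℝ (Fin n) × EuclideanSpace ℝ (Fin n)) :=
  {z | z.1 ≠ z.2 ∧ l < |f z.1 - f z.2| / ‖z.1 - z.2‖ ^ (1 + b)}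

/-- `x ↦ [∫ 1_{E_{l, γ/q}[f]}(x, y) |x - y|^{γ - n} dy]^{1/q}`. -/
noncomputable def differenceFunction {n : ℕ} (l γ q : ℝ) (f : EuclideanSpace ℝ (Fin n) → ℝ)
    (x : EuclideanSpace ℝ (Fin n)) : ℝ≥0∞ :=
  (∫⁻ y, (levelSet l (γ / q) f).indicator
    (fun z => ENNReal.ofReal (‖z.1 - z.2‖ ^ (γ - (n : ℝ)))) (x, y)) ^ (1 / q)

/-- `l * ‖[∫ 1_{E_{l, γ/q}[f]}(·, y) |· - y|^{γ - n} dy]^{1/q}‖_X`. -/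
noncomputable def bvyFunctional {𝕜 : Type*} [RCLike 𝕜] {n : ℕ}
    (N : (EuclideanSpace ℝ (Fin n) → 𝕜) → ℝ≥0∞) (γ q : ℝ) (f : EuclideanSpace ℝ (Fin n) → ℝ)
    (l : ℝ) : ℝ≥0∞ :=
  ENNReal.ofReal l * extNorm N (differenceFunction l γ q f)

/-! Put y = x + z. The q-th power of λ times the inner function is λ^q times the integral of
|z|^(γ-n) over the z with λ|z|^(1+γ/q) < |f(x+z) - f(x)|. If the increment is replaced by a linear
form v·z, polar coordinates give for every λ and either sign of γ exactly |γ|⁻¹ ∫ |v·ω|^q dω =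
κ|v|^q/|γ| (`lintegral_radial`, `lintegral_homogeneous`, `lintegral_toSphere_inner`).

For v = ∇f(x) the Taylor error is at most ε|z| on |z| ≤ d, uniformly in x. Both |v·z| + ε|z| and the
positive part of |v·z| - ε|z| are again homogeneous of degree one, so they are integrated exactly as
well. The scales |z| > d vanish in the limit: for γ > 0 by the Lipschitz bound, for γ < 0 because
the kernel is integrable there and λ^q → 0. Hence λ times the inner function tends to
(κ/|γ|)^(1/q)|∇f| uniformly in x.

Uniform convergence suffices on a ball, whose indicator lies in X. Off a large ball the gradient
vanishes and only a dominating function is needed. For γ > 0 the inner function is zero there once λ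
is large. For γ < 0 it is at most C|x|^(-a/q), with a = n - γ if f is constant near infinity
(compact support, or n ≥ 2 since the exterior of a ball is connected), and a = -γ in general.

That |x|^(-a/q), cut off near 0, has finite norm is where the maximal operator enters. With Y =
X^(1/p), take g in the unit ball of Y' whose integral over B(0,ρ) nearly attains the Y-norm of the
indicator of B(0,ρ). The maximal function of g is at least that integral over |B(0,ρ)| on B(0,1), so
boundedness on Y' forces the Y-norm of the indicator to be O(ρ^n), and its X-norm to be O(ρ^(n/p)).
Dyadic summation then needs exactly n/p < a/q, which is the restriction on q. -/

/-! ### Norms of functions with values in [0, ∞] -/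

section ExtNorm

variable {𝕜 : Type*} [RCLike 𝕜] {n : ℕ} {N : (EuclideanSpace ℝ (Fin n) → 𝕜) → ℝ≥0∞}

lemma extNorm_of_ae_ne_top (N : (EuclideanSpace ℝ (Fin n) → 𝕜) → ℝ≥0∞)
    {u : EuclideanSpace ℝ (Fin n) → ℝ≥0∞} (hu : ∀ᵐ x ∂volume, u x ≠ ∞) :
    extNorm N u = N (fun x => (((u x).toReal : ℝ) : 𝕜)) := if_pos hu

lemma extNorm_of_not_ae_ne_top (N : (EuclideanSpace ℝ (Fin n) → 𝕜) → ℝ≥0∞)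
    {u : EuclideanSpace ℝ (Fin n) → ℝ≥0∞} (hu : ¬ ∀ᵐ x ∂volume, u x ≠ ∞) :
    extNorm N u = ∞ := if_neg hu

lemma ae_ne_top_of_extNorm_ne_top {u : EuclideanSpace ℝ (Fin n) → ℝ≥0∞}
    (hu : extNorm N u ≠ ∞) : ∀ᵐ x ∂volume, u x ≠ ∞ := by
  by_contra h
  exact hu (extNorm_of_not_ae_ne_top N h)

lemma aemeasurable_rclike_ofReal_toReal {u : EuclideanSpace ℝ (Fin n) → ℝ≥0∞}
    (hu : AEMeasurable u volume) :
    AEMeasurable (fun x => (((u x).toReal : ℝ) : 𝕜)) volume :=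
  RCLike.measurable_ofReal.comp_aemeasurable hu.ennreal_toReal

namespace IsBallBanachFunctionSpace

lemma extNorm_mono (hN : IsBallBanachFunctionSpace N) {u v : EuclideanSpace ℝ (Fin n) → ℝ≥0∞}
    (hu : AEMeasurable u volume) (hv : AEMeasurable v volume) (h : ∀ᵐ x ∂volume, u x ≤ v x) :
    extNorm N u ≤ extNorm N v := by
  by_cases hv' : ∀ᵐ x ∂volume, v x ≠ ∞
  · have hu' : ∀ᵐ x ∂volume, u x ≠ ∞ := by
      filter_upwards [hv', h] with x h1 h2 using ne_top_of_le_ne_top h1 h2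
    rw [extNorm_of_ae_ne_top N hv', extNorm_of_ae_ne_top N hu']
    refine hN.mono _ _ (aemeasurable_rclike_ofReal_toReal hv)
      (aemeasurable_rclike_ofReal_toReal hu) ?_
    filter_upwards [hv', h] with x h1 h2
    simpa using ENNReal.toReal_mono h1 h2
  · rw [extNorm_of_not_ae_ne_top N hv']
    exact le_top

lemma norm_eq_extNorm (hN : IsBallBanachFunctionSpace N) {f : EuclideanSpace ℝ (Fin n) → 𝕜}
    (hf : AEMeasurable f volume) : N f = extNorm N (fun x => ‖f x‖ₑ) := by
  rw [extNorm_of_ae_ne_top N (ae_of_all _ fun x => enorm_ne_top)]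
  have h := aemeasurable_rclike_ofReal_toReal (𝕜 := 𝕜) hf.enorm
  refine le_antisymm (hN.mono _ _ h hf ?_) (hN.mono _ _ hf h ?_) <;>
  exact ae_of_all _ fun x => by simp

lemma extNorm_add_le (hN : IsBallBanachFunctionSpace N) {u v : EuclideanSpace ℝ (Fin n) → ℝ≥0∞}
    (hu : AEMeasurable u volume) (hv : AEMeasurable v volume) :
    extNorm N (fun x => u x + v x) ≤ extNorm N u + extNorm N v := by
  by_cases hu' : ∀ᵐ x ∂volume, u x ≠ ∞
  · by_cases hv' : ∀ᵐ x ∂volume, v x ≠ ∞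
    · have huv : ∀ᵐ x ∂volume, u x + v x ≠ ∞ := by
        filter_upwards [hu', hv'] with x h1 h2 using ENNReal.add_ne_top.2 ⟨h1, h2⟩
      rw [extNorm_of_ae_ne_top N hv', extNorm_of_ae_ne_top N hu', extNorm_of_ae_ne_top N huv]
      refine le_trans (hN.mono _ _ ?_ (aemeasurable_rclike_ofReal_toReal (hu.add hv)) ?_)
        (hN.add_le _ _ (aemeasurable_rclike_ofReal_toReal hu)
        (aemeasurable_rclike_ofReal_toReal hv))
      · exact (aemeasurable_rclike_ofReal_toReal hu).add (aemeasurable_rclike_ofReal_toReal hv)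
      · filter_upwards [hu', hv'] with x h1 h2
        rw [ENNReal.toReal_add h1 h2]
        simp
    · rw [extNorm_of_not_ae_ne_top N hv', add_top]
      exact le_top
  · rw [extNorm_of_not_ae_ne_top N hu', top_add]
    exact le_top

/-- For c ≠ 0 the functions u and c * u are infinite at the same points; the alternative in `h` only
sets aside the product 0 * ∞. The case c = 0 is what later shows that the zero function has norm 0.
-/
lemma extNorm_const_mul (hN : IsBallBanachFunctionSpace N) (c : ℝ≥0)
    {u : EuclideanSpace ℝ (Fin n) → ℝ≥0∞} (hu : AEMeasurable u volume) (h : c ≠ 0 ∨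
    ∀ᵐ x ∂volume, u x ≠ ∞) :
    extNorm N (fun x => c * u x) = c * extNorm N u := by
  by_cases hu' : ∀ᵐ x ∂volume, u x ≠ ∞
  · have hcu : ∀ᵐ x ∂volume, c * u x ≠ ∞ := by
      filter_upwards [hu'] with x h1 using ENNReal.mul_ne_top ENNReal.coe_ne_top h1
    rw [extNorm_of_ae_ne_top N hu', extNorm_of_ae_ne_top N hcu]
    have := hN.smul ((c : ℝ) : 𝕜) _ (aemeasurable_rclike_ofReal_toReal hu)
    have hc : ‖((c : ℝ) : 𝕜)‖ₑ = c := by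
      rw [← ofReal_norm]; simp
    rw [hc] at this
    rw [← this]
    congr 1
    ext x
    simp
  · have hc : c ≠ 0 := h.resolve_right hu'
    have hcu : ¬ ∀ᵐ x ∂volume, c * u x ≠ ∞ := by
      intro h'
      apply hu'
      filter_upwards [h'] with x h1 h2
      rw [h2] at h1
      exact h1 (ENNReal.mul_top (by simpa using hc))
    rw [extNorm_of_not_ae_ne_top N hu', extNorm_of_not_ae_ne_top N hcu,
      ENNReal.mul_top (by simpa using hc)]

/-- The Fatou property, for an increasing sequence of functions with an almost everywhere finite
limit. -/
lemma extNorm_le_of_monotone (hN : IsBallBanachFunctionSpace N)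
    {u : ℕ → EuclideanSpace ℝ (Fin n) → ℝ≥0∞} {v : EuclideanSpace ℝ (Fin n) → ℝ≥0∞} {C : ℝ≥0∞}
    (hu : ∀ m, AEMeasurable (u m) volume) (hv : AEMeasurable v volume)
    (hmono : ∀ᵐ x ∂volume, Monotone (fun m => u m x))
    (hlim : ∀ᵐ x ∂volume, Tendsto (fun m => u m x) atTop (𝓝 (v x)))
    (hfin : ∀ᵐ x ∂volume, v x ≠ ∞) (hC : ∀ m, extNorm N (u m) ≤ C) : extNorm N v ≤ C := by
  have hle : ∀ᵐ x ∂volume, ∀ m, u m x ≤ v x := by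
    filter_upwards [hmono, hlim] with x h1 h2 m using h1.ge_of_tendsto h2 m
  have hufin : ∀ m, ∀ᵐ x ∂volume, u m x ≠ ∞ := by
    intro m
    filter_upwards [hle, hfin] with x h1 h2 using ne_top_of_le_ne_top h2 (h1 m)
  rw [extNorm_of_ae_ne_top N hfin]
  refine le_of_tendsto' (hN.fatou (fun m x => (u m x).toReal) (fun x => (v x).toReal)
    (fun m => (hu m).ennreal_toReal) hv.ennreal_toReal ?_) (fun m => ?_)
  · filter_upwards [hle, hfin, hmono, hlim] with x h1 h2 h3 h4
    refine ⟨fun m => ENNReal.toReal_nonneg, fun i j hij => ?_, ?_⟩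
    · exact ENNReal.toReal_mono (ne_top_of_le_ne_top h2 (h1 j)) (h3 hij)
    · exact (ENNReal.tendsto_toReal h2).comp h4
  · rw [← extNorm_of_ae_ne_top N (hufin m)]
    exact hC m

lemma extNorm_indicator_ball_lt_top (hN : IsBallBanachFunctionSpace N)
    (c : EuclideanSpace ℝ (Fin n)) (r : ℝ) :
    extNorm N ((Metric.ball c r).indicator (fun _ => (1 : ℝ≥0∞))) < ∞ := by
  have key : ∀ r : ℝ, 0 < r →
      extNorm N ((Metric.ball c r).indicator (fun _ => (1 : ℝ≥0∞))) < ∞ := by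
    intro r hr
    have h := hN.ball_lt_top c r hr
    rw [hN.norm_eq_extNorm (by
      exact (measurable_const.indicator measurableSet_ball).aemeasurable)] at h
    convert h using 3 with x
    by_cases hx : x ∈ Metric.ball c r <;> simp [hx]
  refine lt_of_le_of_lt (hN.extNorm_mono ?_ ?_ ?_) (key (max r 1) (by positivity))
  · exact (measurable_const.indicator measurableSet_ball).aemeasurable
  · exact (measurable_const.indicator measurableSet_ball).aemeasurable
  · refine ae_of_all _ fun x => ?_
    exact indicator_le_indicator_of_subset (Metric.ball_subset_ball (le_max_left _ _))
      (fun _ => zero_le) x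

lemma extNorm_indicator_ball_pos (hN : IsBallBanachFunctionSpace N)
    (c : EuclideanSpace ℝ (Fin n)) {r : ℝ} (hr : 0 < r) :
    0 < extNorm N ((Metric.ball c r).indicator (fun _ => (1 : ℝ≥0∞))) := by
  rw [pos_iff_ne_zero]
  intro h
  have hfin : ∀ᵐ x ∂(volume : Measure (EuclideanSpace ℝ (Fin n))),
      (Metric.ball c r).indicator (fun _ => (1 : ℝ≥0∞)) x ≠ ∞ :=
    ae_of_all _ fun x => by by_cases hx : x ∈ Metric.ball c r <;> simp [hx]
  rw [extNorm_of_ae_ne_top N hfin] at h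
  have h0 := hN.eq_zero _ (aemeasurable_rclike_ofReal_toReal
    (measurable_const.indicator measurableSet_ball).aemeasurable) h
  have h1 : volume (Metric.ball c r) = 0 := by
    refine measure_mono_null ?_ h0
    intro x hx
    simp [hx]
  exact (Metric.measure_ball_pos volume c hr).ne' h1

end IsBallBanachFunctionSpace

end ExtNorm

/-! ### Duality for indicator functions -/

section Associate

variable {𝕜 : Type*} [RCLike 𝕜] {n : ℕ} {N : (EuclideanSpace ℝ (Fin n) → 𝕜) → ℝ≥0∞}

namespace IsBallBanachFunctionSpace

/-- The tail infima increase to the limit and each lies below a term of the sequence, so the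
monotone Fatou property applies to them. -/
lemma extNorm_le_of_tendsto_ae (hN : IsBallBanachFunctionSpace N)
    {u : ℕ → EuclideanSpace ℝ (Fin n) → ℝ≥0∞} {v : EuclideanSpace ℝ (Fin n) → ℝ≥0∞} {C : ℝ≥0∞}
    (hu : ∀ m, AEMeasurable (u m) volume) (hv : AEMeasurable v volume)
    (hlim : ∀ᵐ x ∂volume, Tendsto (fun m => u m x) atTop (𝓝 (v x)))
    (hfin : ∀ᵐ x ∂volume, v x ≠ ∞) (hC : ∀ m, extNorm N (u m) ≤ C) : extNorm N v ≤ C := by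
  have hw : ∀ m, AEMeasurable (fun x => ⨅ k, u (k + m) x) volume :=
    fun m => AEMeasurable.iInf fun k => hu (k + m)
  have hmono : ∀ x, Monotone (fun m => ⨅ k, u (k + m) x) := by
    intro x i j hij
    refine le_iInf fun k => ?_
    refine (iInf_le _ (k + (j - i))).trans (le_of_eq ?_)
    congr 1
    omega
  refine hN.extNorm_le_of_monotone (u := fun m x => ⨅ k, u (k + m) x) hw hv
    (ae_of_all _ hmono) ?_ hfin fun m => ?_
  · filter_upwards [hlim] with x hx
    have h1 := hx.liminf_eq
    rw [liminf_eq_iSup_iInf_of_nat'] at h1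
    rw [← h1]
    exact tendsto_atTop_iSup (hmono x)
  · refine (hN.extNorm_mono (hw m) (hu m) (ae_of_all _ fun x => ?_)).trans (hC m)
    exact (iInf_le _ 0).trans (by simp)

/-- The closed balls of a ball Banach function space, restricted to `L²`, are convex. -/
lemma convex_extNorm_le (hN : IsBallBanachFunctionSpace N) (θ : ℝ≥0∞) :
    Convex ℝ {u : Lp ℝ 2 (volume : Measure (EuclideanSpace ℝ (Fin n))) |
      extNorm N (fun x => ‖u x‖ₑ) ≤ θ} := by
  intro u hu v hv a b ha hb hab
  simp only [mem_ofPred_eq] at hu hv ⊢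
  have hum : AEMeasurable (fun x => ‖u x‖ₑ) volume := (Lp.aestronglyMeasurable u).enorm
  have hvm : AEMeasurable (fun x => ‖v x‖ₑ) volume := (Lp.aestronglyMeasurable v).enorm
  lift a to ℝ≥0 using ha
  lift b to ℝ≥0 using hb
  calc extNorm N (fun x => ‖((a : ℝ) • u + (b : ℝ) • v : Lp ℝ 2 volume) x‖ₑ)
      ≤ extNorm N (fun x => a * ‖u x‖ₑ + b * ‖v x‖ₑ) := by
        refine hN.extNorm_mono (Lp.aestronglyMeasurable _).enorm
          ((hum.const_mul _).add (hvm.const_mul _)) ?_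
        filter_upwards [Lp.coeFn_add ((a : ℝ) • u) ((b : ℝ) • v), Lp.coeFn_smul (a : ℝ) u,
          Lp.coeFn_smul (b : ℝ) v] with x h1 h2 h3
        rw [h1, Pi.add_apply, h2, h3]
        refine (enorm_add_le _ _).trans (le_of_eq ?_)
        simp [enorm_mul]
    _ ≤ extNorm N (fun x => a * ‖u x‖ₑ) + extNorm N (fun x => b * ‖v x‖ₑ) :=
        hN.extNorm_add_le (hum.const_mul _) (hvm.const_mul _)
    _ = a * extNorm N (fun x => ‖u x‖ₑ) + b * extNorm N (fun x => ‖v x‖ₑ) := by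
        rw [hN.extNorm_const_mul a hum (Or.inr (ae_of_all _ fun x => enorm_ne_top)),
          hN.extNorm_const_mul b hvm (Or.inr (ae_of_all _ fun x => enorm_ne_top))]
    _ ≤ a * θ + b * θ := by gcongr
    _ = θ := by
        rw [← add_mul, ← ENNReal.coe_add, show a + b = 1 from NNReal.eq (by simpa using hab)]
        simp

/-- The closed balls of a ball Banach function space, restricted to `L²`, are closed. -/
lemma isClosed_extNorm_le (hN : IsBallBanachFunctionSpace N) (θ : ℝ≥0∞) :
    IsClosed {u : Lp ℝ 2 (volume : Measure (EuclideanSpace ℝ (Fin n))) |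
      extNorm N (fun x => ‖u x‖ₑ) ≤ θ} := by
  refine IsSeqClosed.isClosed fun u v hu huv => ?_
  obtain ⟨φ, -, hφ⟩ := (tendstoInMeasure_of_tendsto_Lp huv).exists_seq_tendsto_ae
  refine hN.extNorm_le_of_tendsto_ae (u := fun m x => ‖u (φ m) x‖ₑ)
    (fun m => (Lp.aestronglyMeasurable _).enorm) (Lp.aestronglyMeasurable _).enorm ?_
    (ae_of_all _ fun x => enorm_ne_top) (fun m => hu (φ m))
  filter_upwards [hφ] with x hx using hx.enorm

/-- The part of the Lorentz–Luxemburg theorem (`X'' = X`) that concerns indicator functions. -/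
lemma exists_associate_of_lt_extNorm_indicator (hN : IsBallBanachFunctionSpace N)
    {s : Set (EuclideanSpace ℝ (Fin n))} (hs : MeasurableSet s) (hs' : volume s ≠ ∞) {θ : ℝ≥0}
    (hθ : 0 < θ) (hθs : θ < extNorm N (s.indicator (fun _ => 1))) :
    ∃ g : EuclideanSpace ℝ (Fin n) → ℝ, Measurable g ∧
      (∀ u : EuclideanSpace ℝ (Fin n) → 𝕜, AEMeasurable u volume → N u = 1 →
        ∫⁻ x, ‖g x‖ₑ * ‖u x‖ₑ ≤ 1) ∧ θ ≤ ∫⁻ x in s, ‖g x‖ₑ := by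
  set V := {u : Lp ℝ 2 (volume : Measure (EuclideanSpace ℝ (Fin n))) |
      extNorm N (fun x => ‖u x‖ₑ) ≤ θ} with hV
  have hind : indicatorConstLp 2 hs hs' (1 : ℝ) ∉ V := by
    rw [hV, mem_ofPred_eq, not_le]
    refine hθs.trans_le (hN.extNorm_mono (measurable_const.indicator hs).aemeasurable
      (Lp.aestronglyMeasurable _).enorm ?_)
    filter_upwards [indicatorConstLp_coeFn (p := 2) (hs := hs) (hμs := hs') (c := (1 : ℝ))]
      with x hx
    rw [hx]
    by_cases hxs : x ∈ s <;> simp [hxs]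
  -- Hahn–Banach in L² separates the indicator of s from the closed convex set V; by Riesz
  -- representation the separating functional is integration against some g in L².
  obtain ⟨f, t, hft, htf⟩ := geometric_hahn_banach_closed_point (hN.convex_extNorm_le θ)
    (hN.isClosed_extNorm_le θ) hind
  set g := (InnerProductSpace.toDual ℝ _).symm f with hg
  have hgf : ∀ w : Lp ℝ 2 (volume : Measure (EuclideanSpace ℝ (Fin n))), f w = ∫ x, w x * g x := by
    intro w
    rw [← InnerProductSpace.toDual_symm_apply, L2.inner_def]
    rfl
  have hgm : Measurable g := (Lp.stronglyMeasurable g).measurable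
  have h0V : (0 : Lp ℝ 2 (volume : Measure (EuclideanSpace ℝ (Fin n)))) ∈ V := by
    rw [hV, mem_ofPred_eq]
    have h1 := hN.extNorm_const_mul 0 (u := fun _ => 0) aemeasurable_const (Or.inr (by simp))
    simp only [ENNReal.coe_zero, zero_mul] at h1
    refine (hN.extNorm_mono (Lp.aestronglyMeasurable _).enorm (aemeasurable_const (b := 0))
      ?_).trans (h1.le.trans zero_le)
    filter_upwards [Lp.coeFn_zero ℝ 2 (volume : Measure (EuclideanSpace ℝ (Fin n)))] with x hx
    rw [hx]
    simp
  have ht : 0 < t := by simpa using hft 0 h0V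
  -- Membership in V depends only on absolute values, so |w| may be given the sign of g; the bound
  -- on the functional then becomes one on the integral of |g||w|.
  have key : ∀ w : EuclideanSpace ℝ (Fin n) → ℝ, MemLp w 2 volume →
      extNorm N (fun x => ‖w x‖ₑ) ≤ θ → ∫⁻ x, ‖g x‖ₑ * ‖w x‖ₑ ≤ ENNReal.ofReal t := by
    intro w hw hwθ
    have hm : AEStronglyMeasurable (fun x => if 0 ≤ g x then |w x| else -|w x|) volume := by
      have h1 : AEStronglyMeasurable (fun x => (if 0 ≤ g x then (1 : ℝ) else -1) * ‖w x‖)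
          volume := by
        refine AEStronglyMeasurable.mul ?_ hw.1.norm
        exact (Measurable.ite (measurableSet_le measurable_const hgm) measurable_const
          measurable_const).aestronglyMeasurable
      refine h1.congr (ae_of_all _ fun x => ?_)
      by_cases h : 0 ≤ g x <;> simp [h]
    have hw' : MemLp (fun x => if 0 ≤ g x then |w x| else -|w x|) 2 volume := by
      refine hw.of_le hm (ae_of_all _ fun x => ?_)
      by_cases h : 0 ≤ g x <;> simp [h]
    have hV' : hw'.toLp ∈ V := by
      rw [hV, mem_ofPred_eq]
      refine (hN.extNorm_mono (Lp.aestronglyMeasurable _).enorm hw.1.enorm ?_).trans hwθ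
      filter_upwards [hw'.coeFn_toLp] with x hx
      rw [hx]
      by_cases h : 0 ≤ g x <;> simp [h]
    have h2 := (hft _ hV').le
    have hint := L2.integrable_inner (𝕜 := ℝ) g hw'.toLp
    rw [hgf] at h2
    have hae : (fun x => (hw'.toLp _) x * g x) =ᵐ[volume] fun x => |g x| * |w x| := by
      filter_upwards [hw'.coeFn_toLp] with x hx
      rw [hx]
      by_cases h : 0 ≤ g x
      · simp [h, abs_of_nonneg, mul_comm]
      · simp [h, abs_of_neg (not_le.1 h), mul_comm]
    rw [integral_congr_ae hae] at h2
    have hint' : Integrable (fun x => |g x| * |w x|) volume := hint.congr hae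
    rw [← ENNReal.ofReal_le_ofReal_iff ht.le, ofReal_integral_eq_lintegral_ofReal hint'
      (ae_of_all _ fun x => by positivity)] at h2
    refine le_trans (le_of_eq (lintegral_congr fun x => ?_)) h2
    rw [ENNReal.ofReal_mul (abs_nonneg _), Real.enorm_eq_ofReal_abs, Real.enorm_eq_ofReal_abs]
  -- If u has norm 1 then θu has norm θ, so the integral of |g|θ|u| should be at most t, whereas
  -- that of |g| over s is at least t. Scaling by θ / t turns these into the bounds 1 and θ.
  refine ⟨fun x => θ / t * g x, hgm.const_mul _, fun u hu hu1 => ?_, ?_⟩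
  -- Since u need not be in L², θ|u| is truncated in space and in height; Fatou's lemma removes the
  -- truncation.
  · set w : ℕ → EuclideanSpace ℝ (Fin n) → ℝ := fun k =>
      (Metric.ball 0 k).indicator (fun x => θ * min ‖u x‖ k) with hw
    have hwm : ∀ k, AEMeasurable (w k) volume := fun k =>
      ((hu.norm.min aemeasurable_const).const_mul _).indicator measurableSet_ball
    have hw0 : ∀ k x, 0 ≤ w k x ∧ w k x ≤ θ * ‖u x‖ ∧ w k x ≤ θ * k := by
      intro k x
      have h1 : (0 : ℝ) ≤ θ * min ‖u x‖ k := by positivity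
      by_cases hx : x ∈ Metric.ball (0 : EuclideanSpace ℝ (Fin n)) k
      · simp only [hw, indicator_of_mem hx]
        refine ⟨h1, ?_, ?_⟩ <;> gcongr
        exacts [min_le_left _ _, min_le_right _ _]
      · simp only [hw, indicator_of_notMem hx]
        refine ⟨le_rfl, ?_, ?_⟩ <;> positivity
    have hwL : ∀ k, MemLp (w k) 2 volume := by
      intro k
      rw [hw, memLp_indicator_iff_restrict measurableSet_ball]
      have : IsFiniteMeasure ((volume : Measure (EuclideanSpace ℝ (Fin n))).restrict
          (Metric.ball 0 k)) := isFiniteMeasure_restrict.2 measure_ball_lt_top.ne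
      refine MemLp.of_bound ((hu.norm.min aemeasurable_const).const_mul
        _).restrict.aestronglyMeasurable (θ * k) (ae_of_all _ fun x => ?_)
      rw [Real.norm_of_nonneg (by positivity)]
      gcongr
      exact min_le_right _ _
    have hwN : ∀ k, extNorm N (fun x => ‖w k x‖ₑ) ≤ θ := by
      intro k
      have : extNorm N (fun x => θ * ‖u x‖ₑ) = θ := by
        rw [hN.extNorm_const_mul _ hu.enorm (Or.inl hθ.ne'), ← hN.norm_eq_extNorm hu, hu1, mul_one]
      refine (hN.extNorm_mono (hwm k).enorm (hu.enorm.const_mul _) (ae_of_all _ fun x => ?_)).trans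
        this.le
      obtain ⟨h1, h2, -⟩ := hw0 k x
      rw [← ofReal_norm, Real.norm_of_nonneg h1]
      refine (ENNReal.ofReal_le_ofReal h2).trans (le_of_eq ?_)
      rw [ENNReal.ofReal_mul θ.coe_nonneg, ENNReal.ofReal_coe_nnreal, ofReal_norm]
    have hlim : ∀ x, Tendsto (fun k => ‖g x‖ₑ * ‖w k x‖ₑ) atTop
        (𝓝 (‖g x‖ₑ * ‖θ * ‖u x‖‖ₑ)) := by
      intro x
      refine tendsto_const_nhds.congr' ?_
      filter_upwards [eventually_ge_atTop (⌈‖u x‖⌉₊), eventually_gt_atTop (⌈‖x‖⌉₊)] with k h1 h2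
      have h3 : x ∈ Metric.ball (0 : EuclideanSpace ℝ (Fin n)) k := by
        rw [mem_ball_zero_iff]
        exact Nat.lt_of_ceil_lt h2
      simp only [hw, indicator_of_mem h3]
      rw [min_eq_left (Nat.ceil_le.1 h1)]
    have h1 : ∫⁻ x, ‖g x‖ₑ * ‖θ * ‖u x‖‖ₑ ≤ ENNReal.ofReal t := by
      calc ∫⁻ x, ‖g x‖ₑ * ‖θ * ‖u x‖‖ₑ
          = ∫⁻ x, liminf (fun k => ‖g x‖ₑ * ‖w k x‖ₑ) atTop :=
            lintegral_congr fun x => (hlim x).liminf_eq.symm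
        _ ≤ liminf (fun k => ∫⁻ x, ‖g x‖ₑ * ‖w k x‖ₑ) atTop :=
            lintegral_liminf_le' fun k => hgm.enorm.aemeasurable.mul (hwm k).enorm
        _ ≤ ENNReal.ofReal t := liminf_le_of_frequently_le'
            (Frequently.of_forall fun k => key _ (hwL k) (hwN k))
    calc ∫⁻ x, ‖θ / t * g x‖ₑ * ‖u x‖ₑ
        = ∫⁻ x, (ENNReal.ofReal t)⁻¹ * (‖g x‖ₑ * ‖θ * ‖u x‖‖ₑ) := by
          refine lintegral_congr fun x => ?_
          rw [div_eq_inv_mul, mul_assoc, enorm_mul, enorm_mul, enorm_mul, enorm_norm,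
            ← ofReal_norm (t⁻¹), Real.norm_of_nonneg (by positivity), ENNReal.ofReal_inv_of_pos ht]
          ring
      _ = (ENNReal.ofReal t)⁻¹ * ∫⁻ x, ‖g x‖ₑ * ‖θ * ‖u x‖‖ₑ :=
          lintegral_const_mul' _ _ (by simpa using ht)
      _ ≤ (ENNReal.ofReal t)⁻¹ * ENNReal.ofReal t := by gcongr
      _ = 1 := ENNReal.inv_mul_cancel (by simpa using ht) ENNReal.ofReal_ne_top
  · have h1 : ENNReal.ofReal t ≤ ∫⁻ x in s, ‖g x‖ₑ := by
      have h2 := htf.le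
      rw [← InnerProductSpace.toDual_symm_apply, ← hg, real_inner_comm,
        L2.inner_indicatorConstLp_one] at h2
      refine (ENNReal.ofReal_le_ofReal h2).trans ?_
      refine le_trans ?_ (enorm_integral_le_lintegral_enorm _)
      rw [← ofReal_norm]
      exact ENNReal.ofReal_le_ofReal (le_abs_self _)
    calc (θ : ℝ≥0∞) = θ * ((ENNReal.ofReal t)⁻¹ * ENNReal.ofReal t) := by
          rw [ENNReal.inv_mul_cancel (by simpa using ht) ENNReal.ofReal_ne_top, mul_one]
      _ ≤ θ * ((ENNReal.ofReal t)⁻¹ * ∫⁻ x in s, ‖g x‖ₑ) := by gcongr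
      _ = ∫⁻ x in s, θ * ((ENNReal.ofReal t)⁻¹ * ‖g x‖ₑ) := by
          rw [lintegral_const_mul' _ _ ENNReal.coe_ne_top,
            lintegral_const_mul' _ _ (by simpa using ht)]
      _ = ∫⁻ x in s, ‖θ / t * g x‖ₑ := by
          refine lintegral_congr fun x => ?_
          rw [div_eq_mul_inv, enorm_mul, enorm_mul, ← ofReal_norm (t⁻¹),
            Real.norm_of_nonneg (by positivity), ENNReal.ofReal_inv_of_pos ht, mul_assoc]
          simp

end IsBallBanachFunctionSpace

end Associate

/-! ### Growth of the norms of balls, and finite norm of decaying powers -/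

section BallGrowth

variable {𝕜 : Type*} [RCLike 𝕜] {n : ℕ} {N : (EuclideanSpace ℝ (Fin n) → 𝕜) → ℝ≥0∞}

namespace IsBallBanachFunctionSpace

lemma norm_indicator_eq_extNorm (hN : IsBallBanachFunctionSpace N)
    {s : Set (EuclideanSpace ℝ (Fin n))} (hs : MeasurableSet s) :
    N (s.indicator (fun _ => 1)) = extNorm N (s.indicator (fun _ => 1)) := by
  rw [hN.norm_eq_extNorm (measurable_const.indicator hs).aemeasurable]
  congr 1
  ext x
  by_cases hx : x ∈ s <;> simp [hx]

/-- If the maximal operator is bounded on the associate space, the norms of the indicators of balls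
grow at most like their measures. -/
lemma exists_extNorm_indicator_ball_le_volume (hN : IsBallBanachFunctionSpace N)
    (hM : HLMaximalBoundedOn (associateNorm N)) :
    ∃ K : ℝ≥0, ∀ ρ : ℝ, 1 ≤ ρ →
      extNorm N ((Metric.ball 0 ρ).indicator (fun _ => 1)) ≤ K * volume (Metric.ball
        (0 : EuclideanSpace ℝ (Fin n)) ρ) := by
  obtain ⟨C, hC⟩ := hM
  set B : Set (EuclideanSpace ℝ (Fin n)) := Metric.ball 0 1 with hB
  have hBm : MeasurableSet B := measurableSet_ball
  have hvol : 0 < volume B := Metric.measure_ball_pos volume _ one_pos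
  have hvol' : volume B ≠ ∞ := measure_ball_lt_top.ne
  obtain ⟨y, hy⟩ : ∃ y : ℝ≥0, (y : ℝ≥0∞) = extNorm N (B.indicator (fun _ => 1)) :=
    ⟨_, ENNReal.coe_toNNReal (hN.extNorm_indicator_ball_lt_top 0 1).ne⟩
  have hy0 : 0 < y := by
    have := hN.extNorm_indicator_ball_pos 0 one_pos
    rw [← hB, ← hy] at this
    simpa using this
  -- The normalized indicator of the unit ball, used as test function in the associate norm of the
  -- maximal function.
  set v : EuclideanSpace ℝ (Fin n) → 𝕜 :=
    fun x => ((y⁻¹ : ℝ) : 𝕜) * B.indicator (fun _ => 1) x with hv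
  have hind : AEMeasurable (B.indicator (fun _ => (1 : 𝕜))) volume :=
    (measurable_const.indicator hBm).aemeasurable
  have hv1 : N v = 1 := by
    rw [hv, hN.smul _ _ hind, hN.norm_indicator_eq_extNorm hBm, ← hy, ← ofReal_norm]
    simp only [RCLike.norm_ofReal, abs_inv, NNReal.abs_eq]
    rw [ENNReal.ofReal_inv_of_pos (by exact_mod_cast hy0), ENNReal.ofReal_coe_nnreal]
    exact ENNReal.inv_mul_cancel (by exact_mod_cast hy0.ne') ENNReal.coe_ne_top
  refine ⟨C * y / (volume B).toNNReal, fun ρ hρ => ?_⟩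
  set D : Set (EuclideanSpace ℝ (Fin n)) := Metric.ball 0 ρ with hD
  have hBD : B ⊆ D := Metric.ball_subset_ball hρ
  have hDvol : 0 < volume D := Metric.measure_ball_pos volume _ (by linarith)
  have hDvol' : volume D ≠ ∞ := measure_ball_lt_top.ne
  refine ENNReal.le_of_forall_nnreal_lt fun θ hθ => ?_
  rcases eq_or_lt_of_le (zero_le (a := θ)) with rfl | hθ0
  · simp
  obtain ⟨g, hgm, hg1, hg2⟩ := hN.exists_associate_of_lt_extNorm_indicator measurableSet_ball
    hDvol' hθ0 hθ
  have hG : AEMeasurable (fun x => ((g x : ℝ) : 𝕜)) volume :=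
    (RCLike.measurable_ofReal.comp hgm).aemeasurable
  have hGe : ∀ x, ‖((g x : ℝ) : 𝕜)‖ₑ = ‖g x‖ₑ := fun x => by
    rw [← ofReal_norm, ← ofReal_norm]; simp
  have hG1 : associateNorm N (fun x => ((g x : ℝ) : 𝕜)) ≤ 1 := by
    refine iSup₂_le fun u hu => le_trans (le_of_eq (lintegral_congr fun x => ?_))
      (hg1 u hu.1 hu.2)
    rw [enorm_mul, hGe]
  have hMG := (hC _ hG (hG1.trans_lt ENNReal.one_lt_top)).trans (mul_le_of_le_one_right' hG1)
  have hfin := ae_ne_top_of_extNorm_ne_top (ne_top_of_le_ne_top ENNReal.coe_ne_top hMG)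
  rw [extNorm_of_ae_ne_top _ hfin] at hMG
  -- D itself is an admissible ball for every x in B, and the average of |g| over D is at least θ /
  -- |D|.
  have hlow : ∀ x ∈ B, (θ : ℝ≥0∞) / volume D ≤ hlMaximal (fun x => ((g x : ℝ) : 𝕜)) x := by
    intro x hx
    refine le_trans ?_ (le_iSup_of_le 0 (le_iSup₂_of_le ρ ⟨by linarith, hBD hx⟩ le_rfl))
    refine ENNReal.div_le_div_right (hg2.trans (le_of_eq ?_)) _
    exact lintegral_congr fun x => (hGe x).symm
  have h1 : (θ : ℝ≥0∞) / volume D * (y : ℝ≥0∞)⁻¹ * volume B ≤ C := by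
    refine le_trans ?_ ((le_iSup₂_of_le (f := fun (g : EuclideanSpace ℝ (Fin n) → 𝕜)
      (_ : AEMeasurable g volume ∧ N g = 1) => ∫⁻ x, ‖_ * g x‖ₑ) v
      ⟨hind.const_mul _, hv1⟩ le_rfl).trans hMG)
    rw [← setLIntegral_const, ← lintegral_indicator hBm]
    refine lintegral_mono_ae ?_
    filter_upwards [hfin] with x hx
    by_cases hxB : x ∈ B
    · rw [indicator_of_mem hxB]
      simp only [hv, indicator_of_mem hxB, mul_one, enorm_mul]
      gcongr
      · rw [← ofReal_norm, RCLike.norm_ofReal, abs_of_nonneg ENNReal.toReal_nonneg,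
          ENNReal.ofReal_toReal hx]
        exact hlow x hxB
      · rw [← ofReal_norm]
        simp only [RCLike.norm_ofReal, abs_inv, NNReal.abs_eq]
        rw [ENNReal.ofReal_inv_of_pos (by exact_mod_cast hy0), ENNReal.ofReal_coe_nnreal]
    · rw [indicator_of_notMem hxB]
      exact zero_le
  have hyc : (y : ℝ≥0∞) ≠ 0 := by exact_mod_cast hy0.ne'
  have hBt : (volume B).toNNReal ≠ 0 := by
    rw [Ne, ENNReal.toNNReal_eq_zero_iff]
    simp [hvol.ne', hvol']
  rw [ENNReal.coe_div hBt, ENNReal.coe_toNNReal hvol', ENNReal.coe_mul]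
  calc (θ : ℝ≥0∞) = (θ / volume D * (y : ℝ≥0∞)⁻¹ * volume B) * y / volume B * volume D := by
        rw [div_eq_mul_inv, div_eq_mul_inv]
        calc (θ : ℝ≥0∞) = θ * ((volume D)⁻¹ * volume D) * ((y : ℝ≥0∞)⁻¹ * y) *
              (volume B * (volume B)⁻¹) := by
              rw [ENNReal.inv_mul_cancel hDvol.ne' hDvol', ENNReal.inv_mul_cancel hyc
                ENNReal.coe_ne_top, ENNReal.mul_inv_cancel hvol.ne' hvol']
              simp
          _ = _ := by ring
    _ ≤ C * y / volume B * volume D := by gcongr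

/-- If the maximal operator is bounded on `(X^{1/p})'`, the norms of the indicators of balls of
radius `ρ` grow at most like `ρ ^ (n / p)`. -/
lemma exists_extNorm_indicator_ball_le_rpow (hN : IsBallBanachFunctionSpace N) {p : ℝ}
    (hp : 0 < p) (hY : IsBallBanachFunctionSpace (convexificationNorm N (1 / p)))
    (hM : HLMaximalBoundedOn (associateNorm (convexificationNorm N (1 / p)))) :
    ∃ K : ℝ≥0, ∀ ρ : ℝ, 1 ≤ ρ →
      extNorm N ((Metric.ball 0 ρ).indicator (fun _ => 1)) ≤
        K * ENNReal.ofReal (ρ ^ ((n : ℝ) / p)) := by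
  obtain ⟨K, hK⟩ := hY.exists_extNorm_indicator_ball_le_volume hM
  set b : ℝ≥0∞ := volume (Metric.ball (0 : EuclideanSpace ℝ (Fin n)) 1) with hb
  have hbt : b ≠ ∞ := measure_ball_lt_top.ne
  -- An indicator equals its own powers, so its norm in X^(1/p) is the p-th power of its norm in X.
  -- The constant is the p-th root of the bound K * |B(0,ρ)| = K * b * ρ^n, without its factor
  -- ρ^(n/p).
  refine ⟨(K * b.toNNReal) ^ (1 / p), fun ρ hρ => ?_⟩
  have h := hK ρ hρ
  rw [← hY.norm_indicator_eq_extNorm measurableSet_ball, convexificationNorm] at h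
  have h1 : (fun x => ((‖(Metric.ball (0 : EuclideanSpace ℝ (Fin n)) ρ).indicator
      (fun _ => (1 : 𝕜)) x‖ ^ (1 / p) : ℝ) : 𝕜)) =
      (Metric.ball (0 : EuclideanSpace ℝ (Fin n)) ρ).indicator (fun _ => (1 : 𝕜)) := by
    ext x
    by_cases hx : x ∈ Metric.ball (0 : EuclideanSpace ℝ (Fin n)) ρ
    · simp [hx]
    · simp only [indicator_of_notMem hx, norm_zero]
      rw [Real.zero_rpow (by positivity), RCLike.ofReal_zero]
  rw [h1, hN.norm_indicator_eq_extNorm measurableSet_ball, one_div_one_div,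
    Measure.addHaar_ball_of_pos _ _ (by linarith), finrank_euclideanSpace_fin] at h
  have h2 := ENNReal.rpow_le_rpow h (z := 1 / p) (by positivity)
  rw [← ENNReal.rpow_mul, mul_one_div_cancel hp.ne', ENNReal.rpow_one] at h2
  refine h2.trans (le_of_eq ?_)
  have h3 : ENNReal.ofReal (ρ ^ ((n : ℝ) / p)) = ENNReal.ofReal (ρ ^ n) ^ (1 / p) := by
    rw [ENNReal.ofReal_rpow_of_nonneg (by positivity) (by positivity), ← Real.rpow_natCast,
      ← Real.rpow_mul (by linarith)]
    congr 2
    ring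
  rw [ENNReal.coe_rpow_of_nonneg _ (by positivity), h3, ENNReal.coe_mul, ENNReal.coe_toNNReal hbt,
    ← ENNReal.mul_rpow_of_nonneg _ _ (by positivity)]
  congr 1
  ring

/-- Power decay faster than the growth of balls gives a finite norm. -/
lemma extNorm_indicator_rpow_lt_top (hN : IsBallBanachFunctionSpace N) {a s : ℝ} (has : a < s)
    (hs : 0 ≤ s) {K : ℝ≥0} (hK : ∀ ρ : ℝ, 1 ≤ ρ →
      extNorm N ((Metric.ball 0 ρ).indicator (fun _ => 1)) ≤ K * ENNReal.ofReal (ρ ^ a)) :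
    extNorm N (({x | 1 ≤ ‖x‖} : Set (EuclideanSpace ℝ (Fin n))).indicator
      (fun x => ENNReal.ofReal (‖x‖ ^ (-s)))) < ∞ := by
  set w : EuclideanSpace ℝ (Fin n) → ℝ≥0∞ :=
    ({x | 1 ≤ ‖x‖} : Set (EuclideanSpace ℝ (Fin n))).indicator
      (fun x => ENNReal.ofReal (‖x‖ ^ (-s))) with hw
  have hset : MeasurableSet ({x | 1 ≤ ‖x‖} : Set (EuclideanSpace ℝ (Fin n))) :=
    measurableSet_le measurable_const measurable_norm
  have hwm : Measurable w := Measurable.indicator (by fun_prop) hset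
  set F : ℕ → EuclideanSpace ℝ (Fin n) → ℝ≥0∞ := fun m => (Metric.ball 0 (2 ^ m)).indicator w
    with hF
  have hFm : ∀ m, Measurable (F m) := fun m => hwm.indicator measurableSet_ball
  set r : ℝ≥0∞ := ENNReal.ofReal (2 ^ (a - s)) with hr
  have hr1 : r < 1 := by
    rw [hr, ← ENNReal.ofReal_one, ENNReal.ofReal_lt_ofReal_iff one_pos]
    exact Real.rpow_lt_one_of_one_lt_of_neg (by norm_num) (by linarith)
  set c : ℝ≥0∞ := K * ENNReal.ofReal (2 ^ a) with hc
  -- On the annulus 2^j ≤ |x| < 2^(j+1) the function is at most 2^(-js), and the ball containing it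
  -- has norm at most K * 2^((j+1)a); the product is c * r^j with r = 2^(a-s) < 1.
  have hstep : ∀ m, extNorm N (F m) ≤ ∑ j ∈ Finset.range m, c * r ^ j := by
    intro m
    induction m with
    | zero =>
      have h1 := hN.extNorm_const_mul 0 (u := fun _ => 0) aemeasurable_const (Or.inr (by simp))
      simp only [ENNReal.coe_zero, zero_mul] at h1
      refine (hN.extNorm_mono (hFm 0).aemeasurable (aemeasurable_const (b := 0))
        (ae_of_all _ fun x => ?_)).trans (h1.le.trans zero_le)
      by_cases hx : ‖x‖ < 1
      · simp [hF, hw, hx]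
      · simp [hF, hx]
    | succ m ih =>
      rw [Finset.sum_range_succ]
      set d : ℝ≥0 := ((2 : ℝ≥0) ^ m) ^ (-s) with hd
      have hind : AEMeasurable ((Metric.ball (0 : EuclideanSpace ℝ (Fin n))
        (2 ^ (m + 1))).indicator (fun _ => (1 : ℝ≥0∞))) volume :=
        (measurable_const.indicator measurableSet_ball).aemeasurable
      have hd0 : d ≠ 0 := by positivity
      have h1 : extNorm N (F (m + 1)) ≤ extNorm N (fun x => F m x +
          d * (Metric.ball 0 (2 ^ (m + 1))).indicator (fun _ => 1) x) := by
        refine hN.extNorm_mono (hFm _).aemeasurable ((hFm m).aemeasurable.add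
          (hind.const_mul _)) (ae_of_all _ fun x => ?_)
        by_cases hx : x ∈ Metric.ball (0 : EuclideanSpace ℝ (Fin n)) (2 ^ m)
        · have hx' : x ∈ Metric.ball (0 : EuclideanSpace ℝ (Fin n)) (2 ^ (m + 1)) :=
            Metric.ball_subset_ball (by gcongr <;> simp) hx
          simp [hF, indicator_of_mem hx, indicator_of_mem hx']
        · by_cases hx' : x ∈ Metric.ball (0 : EuclideanSpace ℝ (Fin n)) (2 ^ (m + 1))
          · simp only [hF, indicator_of_notMem hx, indicator_of_mem hx', mul_one, zero_add]
            refine (indicator_le_self _ _ _).trans ?_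
            rw [← ENNReal.ofReal_coe_nnreal]
            refine ENNReal.ofReal_le_ofReal ?_
            rw [hd, NNReal.coe_rpow]
            push_cast
            rw [mem_ball_zero_iff, not_lt] at hx
            exact Real.rpow_le_rpow_of_nonpos (by positivity) hx (by linarith)
          · simp [hF, indicator_of_notMem hx']
      refine h1.trans ((hN.extNorm_add_le (hFm m).aemeasurable (hind.const_mul _)).trans ?_)
      refine add_le_add ih ?_
      rw [hN.extNorm_const_mul _ hind (Or.inl hd0)]
      refine (mul_le_mul_right (hK _ (one_le_pow₀ (by norm_num))) _).trans (le_of_eq ?_)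
      rw [hc, hr, ← ENNReal.ofReal_pow (by positivity), ← ENNReal.ofReal_coe_nnreal (p := d),
        mul_left_comm, mul_assoc, ← ENNReal.ofReal_mul (by positivity),
        ← ENNReal.ofReal_mul (by positivity)]
      congr 2
      rw [hd, NNReal.coe_rpow]
      push_cast
      rw [← Real.rpow_natCast, ← Real.rpow_natCast, ← Real.rpow_natCast,
        ← Real.rpow_mul (by norm_num), ← Real.rpow_mul (by norm_num),
        ← Real.rpow_mul (by norm_num), ← Real.rpow_add (by norm_num), ← Real.rpow_add (by norm_num)]
      congr 1
      push_cast
      ring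
  have hbound : ∀ m, extNorm N (F m) ≤ c * (1 - r)⁻¹ := by
    intro m
    refine (hstep m).trans ?_
    rw [← Finset.mul_sum, ← ENNReal.tsum_geometric]
    gcongr
    exact ENNReal.sum_le_tsum _
  have hfin : ∀ x, w x ≠ ∞ := fun x => by
    by_cases hx : 1 ≤ ‖x‖ <;> simp [hw, hx]
  refine (hN.extNorm_le_of_monotone (fun m => (hFm m).aemeasurable) hwm.aemeasurable
    (ae_of_all _ fun x i j hij => ?_) (ae_of_all _ fun x => ?_) (ae_of_all _ hfin)
    hbound).trans_lt ?_
  · exact indicator_le_indicator_of_subset (Metric.ball_subset_ball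
      (pow_le_pow_right₀ (by norm_num) hij)) (fun _ => zero_le) x
  · refine tendsto_const_nhds.congr' ?_
    filter_upwards [(tendsto_pow_atTop_atTop_of_one_lt (r := (2 : ℝ)) (by norm_num)).eventually
      (eventually_gt_atTop ‖x‖)] with m hm
    rw [hF]
    simp [hm]
  · refine ENNReal.mul_lt_top (ENNReal.mul_lt_top ENNReal.coe_lt_top ENNReal.ofReal_lt_top) ?_
    rw [ENNReal.inv_lt_top]
    exact tsub_pos_of_lt hr1

end IsBallBanachFunctionSpace

end BallGrowth

/-! ### Polar coordinates and exact integrals for homogeneous increments -/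

section Polar

/-- Integration in polar coordinates. -/
lemma lintegral_eq_lintegral_toSphere {E : Type*} [NormedAddCommGroup E] [NormedSpace ℝ E]
    [MeasurableSpace E] [BorelSpace E] [FiniteDimensional ℝ E] [Nontrivial E] (μ : Measure E)
    [μ.IsAddHaarMeasure] {F : E → ℝ≥0∞} (hF : Measurable F) :
    ∫⁻ z, F z ∂μ = ∫⁻ ω : Metric.sphere (0 : E) 1, (∫⁻ r in Ioi (0 : ℝ),
      ENNReal.ofReal (r ^ (Module.finrank ℝ E - 1)) * F (r • (ω : E))) ∂μ.toSphere := by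
  have hG : Measurable fun p : Metric.sphere (0 : E) 1 × Ioi (0 : ℝ) =>
      F ((p.2 : ℝ) • (p.1 : E)) := by
    refine hF.comp ?_
    exact (measurable_subtype_coe.comp measurable_snd).smul
      (measurable_subtype_coe.comp measurable_fst)
  calc ∫⁻ z, F z ∂μ = ∫⁻ z in {(0 : E)}ᶜ, F z ∂μ := by rw [restrict_compl_singleton]
    _ = ∫⁻ z : ({(0 : E)}ᶜ : Set E), F z ∂(μ.comap (↑)) :=
        (lintegral_subtype_comap (measurableSet_singleton _).compl F).symm
    _ = ∫⁻ p, F ((p.2 : ℝ) • (p.1 : E)) ∂(μ.toSphere.prod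
          (Measure.volumeIoiPow (Module.finrank ℝ E - 1))) := by
        rw [← μ.measurePreserving_homeomorphUnitSphereProd.lintegral_comp hG]
        refine lintegral_congr fun z => ?_
        have hz : ‖(z : E)‖ ≠ 0 := norm_ne_zero_iff.2 z.2
        simp [smul_smul, hz]
    _ = ∫⁻ ω : Metric.sphere (0 : E) 1, ∫⁻ r, F ((r : ℝ) • (ω : E))
          ∂(Measure.volumeIoiPow (Module.finrank ℝ E - 1)) ∂μ.toSphere :=
        lintegral_prod _ hG.aemeasurable
    _ = _ := by
        refine lintegral_congr fun ω => ?_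
        have hFω : Measurable fun r : ℝ => F (r • (ω : E)) :=
          hF.comp (measurable_id.smul_const _)
        refine (lintegral_withDensity_eq_lintegral_mul _ (by fun_prop)
          (g := fun r : Ioi (0 : ℝ) => F ((r : ℝ) • (ω : E)))
          (hFω.comp measurable_subtype_coe)).trans ?_
        exact lintegral_subtype_comap measurableSet_Ioi
          (fun r : ℝ => ENNReal.ofReal (r ^ (Module.finrank ℝ E - 1)) * F (r • (ω : E)))

lemma lintegral_Ioo_rpow {γ ρ : ℝ} (hγ : 0 < γ) (hρ : 0 ≤ ρ) :
    ∫⁻ r in Ioo 0 ρ, ENNReal.ofReal (r ^ (γ - 1)) = ENNReal.ofReal (ρ ^ γ / γ) := by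
  have h1 : IntegrableOn (fun r : ℝ => r ^ (γ - 1)) (Ioc 0 ρ) :=
    (intervalIntegral.intervalIntegrable_rpow' (by linarith)).1
  rw [Measure.restrict_congr_set Ioo_ae_eq_Ioc, ← ofReal_integral_eq_lintegral_ofReal h1 ?_,
    ← intervalIntegral.integral_of_le hρ, integral_rpow (Or.inl (by linarith))]
  · simp [Real.zero_rpow hγ.ne']
  · filter_upwards [ae_restrict_mem measurableSet_Ioc] with r hr
    exact Real.rpow_nonneg hr.1.le _

lemma lintegral_Ioi_rpow {γ ρ : ℝ} (hγ : γ < 0) (hρ : 0 < ρ) :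
    ∫⁻ r in Ioi ρ, ENNReal.ofReal (r ^ (γ - 1)) = ENNReal.ofReal (ρ ^ γ / (-γ)) := by
  have h1 : IntegrableOn (fun r : ℝ => r ^ (γ - 1)) (Ioi ρ) :=
    integrableOn_Ioi_rpow_of_lt (by linarith) hρ
  rw [← ofReal_integral_eq_lintegral_ofReal h1 ?_, integral_Ioi_rpow_of_lt (by linarith) hρ]
  · congr 1
    rw [sub_add_cancel, neg_div, div_neg]
  · filter_upwards [ae_restrict_mem measurableSet_Ioi] with r hr
    exact Real.rpow_nonneg (hρ.le.trans (le_of_lt hr)) _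

/-- The radial integral behind the limiting identities. -/
lemma lintegral_radial {γ q l A : ℝ} (hγ : γ ≠ 0) (hq : 0 < q) (hl : 0 < l) (hA : 0 ≤ A) :
    ENNReal.ofReal (l ^ q) * ∫⁻ r in Ioi (0 : ℝ), {r : ℝ | l * r ^ (γ / q) < A}.indicator
      (fun r => ENNReal.ofReal (r ^ (γ - 1))) r = ENNReal.ofReal (A ^ q / |γ|) := by
  rcases eq_or_lt_of_le hA with rfl | hA
  · have : ∫⁻ r in Ioi (0 : ℝ), {r : ℝ | l * r ^ (γ / q) < 0}.indicator
        (fun r => ENNReal.ofReal (r ^ (γ - 1))) r = 0 := by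
      refine (setLIntegral_congr_fun measurableSet_Ioi fun r hr => ?_).trans lintegral_zero
      refine indicator_of_notMem ?_ _
      simp only [mem_ofPred_eq, not_lt]
      have : 0 < r := hr
      positivity
    rw [this, Real.zero_rpow hq.ne']
    simp
  -- The radius at which l * r^(γ/q) equals A. The admissible r form (ρ, ∞) for γ < 0 and (0, ρ) for
  -- γ > 0; in both cases the integral is ρ^γ / |γ| with ρ^γ = (A / l)^q.
  set ρ : ℝ := (A / l) ^ (q / γ) with hρ
  have hAl : 0 < A / l := by positivity
  have hρ0 : 0 < ρ := by positivity
  have hρb : ρ ^ (γ / q) = A / l := by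
    rw [hρ, ← Real.rpow_mul hAl.le, div_mul_div_cancel₀ hγ, div_self hq.ne', Real.rpow_one]
  have hργ : ρ ^ γ = (A / l) ^ q := by
    rw [hρ, ← Real.rpow_mul hAl.le, div_mul_cancel₀ _ hγ]
  have hfin : ENNReal.ofReal (l ^ q) * ENNReal.ofReal ((A / l) ^ q / |γ|) =
      ENNReal.ofReal (A ^ q / |γ|) := by
    rw [← ENNReal.ofReal_mul (by positivity), Real.div_rpow hA.le hl.le]
    congr 1
    have : l ^ q ≠ 0 := by positivity
    field_simp
  rcases lt_or_gt_of_ne hγ with hγ' | hγ'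
  · have hset : ∀ r ∈ Ioi (0 : ℝ), {r : ℝ | l * r ^ (γ / q) < A}.indicator
        (fun r => ENNReal.ofReal (r ^ (γ - 1))) r = (Ioi ρ).indicator
        (fun r => ENNReal.ofReal (r ^ (γ - 1))) r := by
      intro r hr
      have hr : 0 < r := hr
      have : l * r ^ (γ / q) < A ↔ ρ < r := by
        rw [mul_comm, ← lt_div_iff₀ hl, ← hρb,
          Real.rpow_lt_rpow_iff_of_neg hr hρ0 (div_neg_of_neg_of_pos hγ' hq)]
      simp only [indicator, mem_ofPred_eq, mem_Ioi, this]
    rw [setLIntegral_congr_fun measurableSet_Ioi hset, lintegral_indicator measurableSet_Ioi,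
      Measure.restrict_restrict measurableSet_Ioi,
      inter_eq_self_of_subset_left (Ioi_subset_Ioi hρ0.le), lintegral_Ioi_rpow hγ' hρ0, hργ,
      ← abs_of_neg hγ', hfin]
  · have hset : ∀ r ∈ Ioi (0 : ℝ), {r : ℝ | l * r ^ (γ / q) < A}.indicator
        (fun r => ENNReal.ofReal (r ^ (γ - 1))) r = (Iio ρ).indicator
        (fun r => ENNReal.ofReal (r ^ (γ - 1))) r := by
      intro r hr
      have hr : 0 < r := hr
      have : l * r ^ (γ / q) < A ↔ r < ρ := by
        rw [mul_comm, ← lt_div_iff₀ hl, ← hρb,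
          Real.rpow_lt_rpow_iff hr.le hρ0.le (by positivity)]
      simp only [indicator, mem_ofPred_eq, mem_Iio, this]
    rw [setLIntegral_congr_fun measurableSet_Ioi hset, lintegral_indicator measurableSet_Iio,
      Measure.restrict_restrict measurableSet_Iio, inter_comm, Ioi_inter_Iio,
      lintegral_Ioo_rpow hγ' hρ0.le, hργ, ← abs_of_pos hγ', abs_abs, hfin]

variable {n : ℕ}

lemma measurable_norm_rpow (a : ℝ) :
    Measurable fun z : EuclideanSpace ℝ (Fin n) => ENNReal.ofReal (‖z‖ ^ a) := by fun_prop

/-- A homogeneous model for the difference function: the angular function `A` stands for the size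
of the difference quotient. It is presented as a function on the space which is homogeneous of
degree one. -/
lemma lintegral_homogeneous (hn : 1 ≤ n) {γ q l : ℝ} (hγ : γ ≠ 0) (hq : 0 < q) (hl : 0 < l)
    {A : EuclideanSpace ℝ (Fin n) → ℝ} (hA : Measurable A) (hA0 : ∀ z, 0 ≤ A z)
    (hA1 : ∀ r : ℝ, 0 < r → ∀ z, A (r • z) = r * A z) :
    ENNReal.ofReal (l ^ q) * ∫⁻ z : EuclideanSpace ℝ (Fin n),
      {z | l * ‖z‖ ^ (1 + γ / q) < A z}.indicator (fun z => ENNReal.ofReal (‖z‖ ^ (γ - n))) z =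
    ∫⁻ ω : Metric.sphere (0 : EuclideanSpace ℝ (Fin n)) 1, ENNReal.ofReal (A ω ^ q / |γ|)
      ∂(volume : Measure (EuclideanSpace ℝ (Fin n))).toSphere := by
  have : NeZero n := ⟨by omega⟩
  have hset : MeasurableSet {z : EuclideanSpace ℝ (Fin n) | l * ‖z‖ ^ (1 + γ / q) < A z} :=
    measurableSet_lt (by fun_prop) hA
  rw [lintegral_eq_lintegral_toSphere _ ((measurable_norm_rpow _).indicator hset),
    ← lintegral_const_mul' _ _ ENNReal.ofReal_ne_top]
  refine lintegral_congr fun ω => ?_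
  rw [← lintegral_radial hγ hq hl (hA0 ω)]
  congr 1
  refine setLIntegral_congr_fun measurableSet_Ioi fun r hr => ?_
  have hr : 0 < r := hr
  have hnorm : ‖r • (ω : EuclideanSpace ℝ (Fin n))‖ = r := by
    rw [norm_smul, norm_eq_of_mem_sphere, mul_one, Real.norm_of_nonneg hr.le]
  have hiff : l * r ^ (1 + γ / q) < r * A ω ↔ l * r ^ (γ / q) < A ω := by
    rw [Real.rpow_add hr, Real.rpow_one, mul_left_comm, mul_lt_mul_iff_right₀ hr]
  simp only [indicator, mem_ofPred_eq, hnorm, hA1 r hr, hiff, finrank_euclideanSpace_fin]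
  split_ifs
  · rw [← ENNReal.ofReal_mul (by positivity), ← Real.rpow_natCast, ← Real.rpow_add hr,
      Nat.cast_sub hn]
    congr 2
    push_cast
    ring
  · simp

/-- The tail of the kernel `‖z‖ ^ (γ - n)`. -/
lemma lintegral_tail (hn : 1 ≤ n) {γ : ℝ} (hγ : γ < 0) :
    ∃ K : ℝ≥0, ∀ d : ℝ, 0 < d → ∫⁻ z : EuclideanSpace ℝ (Fin n),
      {z | d < ‖z‖}.indicator (fun z => ENNReal.ofReal (‖z‖ ^ (γ - n))) z ≤
        K * ENNReal.ofReal (d ^ γ) := by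
  -- For q = 1, l = d^(-γ) and A the norm, the condition d^(-γ) * |z|^(1+γ) < |z| amounts to d < |z|
  -- because γ < 0.
  have h0 := fun (d : ℝ) (hd : 0 < d) => lintegral_homogeneous hn hγ.ne one_pos
    (l := d ^ (-γ)) (by positivity) (A := fun z => ‖z‖) measurable_norm
    (fun z => norm_nonneg z) (fun r hr z => by rw [norm_smul, Real.norm_of_nonneg hr.le])
  set I : ℝ≥0∞ := ∫⁻ ω : Metric.sphere (0 : EuclideanSpace ℝ (Fin n)) 1,
    ENNReal.ofReal (‖(ω : EuclideanSpace ℝ (Fin n))‖ ^ (1 : ℝ) / |γ|)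
      ∂(volume : Measure (EuclideanSpace ℝ (Fin n))).toSphere with hI
  have hIt : I ≠ ∞ := by
    have : I = ∫⁻ ω : Metric.sphere (0 : EuclideanSpace ℝ (Fin n)) 1, ENNReal.ofReal (1 / |γ|)
      ∂(volume : Measure (EuclideanSpace ℝ (Fin n))).toSphere :=
      lintegral_congr fun ω => by rw [norm_eq_of_mem_sphere, Real.one_rpow]
    rw [this, lintegral_const]
    exact ENNReal.mul_ne_top ENNReal.ofReal_ne_top (measure_ne_top _ _)
  refine ⟨I.toNNReal, fun d hd => ?_⟩
  rw [ENNReal.coe_toNNReal hIt, ← h0 d hd, mul_right_comm,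
    ← ENNReal.ofReal_mul (by positivity), Real.rpow_one, ← Real.rpow_add hd, neg_add_cancel,
    Real.rpow_zero, ENNReal.ofReal_one, one_mul]
  refine lintegral_mono fun z => ?_
  have hiff : ∀ z : EuclideanSpace ℝ (Fin n), d < ‖z‖ → d ^ (-γ) * ‖z‖ ^ (1 + γ / 1) < ‖z‖ := by
    intro z h
    have hz : 0 < ‖z‖ := hd.trans h
    rw [div_one, Real.rpow_add hz, Real.rpow_one, Real.rpow_neg hd.le, mul_left_comm]
    refine mul_lt_of_lt_one_right hz ?_
    rw [inv_mul_lt_one₀ (by positivity)]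
    exact Real.rpow_lt_rpow_of_neg hd h hγ
  exact indicator_le_indicator_of_subset (fun z hz => hiff z hz) (fun _ => zero_le) z

/-- The integral defining `kappa`, in any direction. -/
lemma lintegral_toSphere_inner (hn : 1 ≤ n) {q : ℝ} (hq : 0 < q)
    {e : EuclideanSpace ℝ (Fin n)} (he : ‖e‖ = 1) (v : EuclideanSpace ℝ (Fin n)) :
    ∫⁻ ω : Metric.sphere (0 : EuclideanSpace ℝ (Fin n)) 1,
      ENNReal.ofReal (|inner ℝ v (ω : EuclideanSpace ℝ (Fin n))| ^ q)
        ∂(volume : Measure (EuclideanSpace ℝ (Fin n))).toSphere =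
      ENNReal.ofReal (kappa q e * ‖v‖ ^ q) := by
  have hA : ∀ w : EuclideanSpace ℝ (Fin n), Measurable fun z => |inner ℝ w z| := fun w => by
    fun_prop
  have hhom := fun w : EuclideanSpace ℝ (Fin n) => lintegral_homogeneous hn one_ne_zero hq one_pos
    (A := fun z => |inner ℝ w z|) (hA w) (fun z => abs_nonneg _)
    (fun r hr z => by rw [real_inner_smul_right, abs_mul, abs_of_pos hr])
  simp only [abs_one, div_one, Real.one_rpow, ENNReal.ofReal_one, one_mul] at hhom
  set w := ‖v‖ • e with hw
  have hvw : ‖v‖ = ‖w‖ := by rw [hw, norm_smul, he, mul_one, norm_norm]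
  -- The reflection exchanging v and ‖v‖ • e. Its invariance is needed for the sphere integral, but
  -- is used for Lebesgue measure: the homogeneous formula with γ = l = 1 rewrites the sphere
  -- integral as one over the whole space.
  set R := (Submodule.span ℝ {v - w})ᗮ.reflection with hR
  have hRv : R v = w := Submodule.reflection_sub hvw
  have hrot : ∫⁻ ω : Metric.sphere (0 : EuclideanSpace ℝ (Fin n)) 1,
      ENNReal.ofReal (|inner ℝ v (ω : EuclideanSpace ℝ (Fin n))| ^ q)
        ∂(volume : Measure (EuclideanSpace ℝ (Fin n))).toSphere =
      ∫⁻ ω : Metric.sphere (0 : EuclideanSpace ℝ (Fin n)) 1,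
      ENNReal.ofReal (|inner ℝ w (ω : EuclideanSpace ℝ (Fin n))| ^ q)
        ∂(volume : Measure (EuclideanSpace ℝ (Fin n))).toSphere := by
    rw [← hhom v, ← hhom w]
    have hset : MeasurableSet {z : EuclideanSpace ℝ (Fin n) |
        ‖z‖ ^ (1 + 1 / q) < |inner ℝ w z|} := measurableSet_lt (by fun_prop) (hA w)
    rw [← R.measurePreserving.lintegral_comp ((measurable_norm_rpow _).indicator hset)]
    refine lintegral_congr fun z => ?_
    have : inner ℝ w (R z) = inner ℝ v z := by rw [← hRv, R.inner_map_map]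
    simp only [indicator, mem_ofPred_eq, this, R.norm_map]
  have hcont : Continuous fun ω : Metric.sphere (0 : EuclideanSpace ℝ (Fin n)) 1 =>
      |inner ℝ e (ω : EuclideanSpace ℝ (Fin n))| ^ q :=
    Continuous.rpow_const (by fun_prop) fun _ => Or.inr hq.le
  have hint : Integrable (fun ω : Metric.sphere (0 : EuclideanSpace ℝ (Fin n)) 1 =>
      |inner ℝ e (ω : EuclideanSpace ℝ (Fin n))| ^ q)
      (volume : Measure (EuclideanSpace ℝ (Fin n))).toSphere :=
    hcont.integrable_of_hasCompactSupport (HasCompactSupport.of_compactSpace _)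
  rw [hrot, kappa, mul_comm, ENNReal.ofReal_mul (by positivity),
    ofReal_integral_eq_lintegral_ofReal hint (ae_of_all _ fun ω => by positivity),
    ← lintegral_const_mul' _ _ ENNReal.ofReal_ne_top]
  refine lintegral_congr fun ω => ?_
  rw [← ENNReal.ofReal_mul (by positivity), ← Real.mul_rpow (norm_nonneg _) (abs_nonneg _), hw,
    real_inner_smul_left, abs_mul, abs_norm]

lemma kappa_nonneg (q : ℝ) (e : EuclideanSpace ℝ (Fin n)) : 0 ≤ kappa q e :=
  integral_nonneg fun _ => by positivity

end Polar

/-! ### Uniform comparison of the difference function with the gradient -/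

section Uniform

variable {n : ℕ}

lemma norm_fderiv_eq_norm_gradient {E : Type*} [NormedAddCommGroup E] [InnerProductSpace ℝ E]
    [CompleteSpace E] (f : E → ℝ) (x : E) : ‖fderiv ℝ f x‖ = ‖gradient f x‖ := by
  rw [← toDual_gradient, LinearIsometryEquiv.norm_map]

lemma hasCompactSupport_fderiv {f : EuclideanSpace ℝ (Fin n) → ℝ}
    (hs : HasCompactSupport fun x => ‖gradient f x‖) : HasCompactSupport (fderiv ℝ f) := by
  rw [← hasCompactSupport_norm_iff]
  simpa only [norm_fderiv_eq_norm_gradient] using hs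

/-- A function with compactly supported continuous gradient is Lipschitz. -/
lemma exists_bound_gradient {f : EuclideanSpace ℝ (Fin n) → ℝ} (hf : ContDiff ℝ 1 f)
    (hs : HasCompactSupport fun x => ‖gradient f x‖) :
    ∃ L : ℝ, 0 < L ∧ (∀ x, ‖gradient f x‖ ≤ L) ∧ ∀ x z, |f (x + z) - f x| ≤ L * ‖z‖ := by
  obtain ⟨L, hL⟩ := (hf.continuous_fderiv (by simp)).bounded_above_of_compact_support
    (hasCompactSupport_fderiv hs)
  have hL' : ∀ x, ‖fderiv ℝ f x‖ ≤ max L 1 := fun x => (hL x).trans (le_max_left _ _)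
  refine ⟨max L 1, by positivity, fun x => ?_, fun x z => ?_⟩
  · rw [← norm_fderiv_eq_norm_gradient]
    exact hL' x
  · have := convex_univ.norm_image_sub_le_of_norm_fderiv_le
      (fun y _ => (hf.differentiable (by simp)).differentiableAt) (fun y _ => hL' y)
      (mem_univ x) (mem_univ (x + z))
    simpa using this

/-- Uniform first order expansion. -/
lemma exists_forall_abs_sub_inner_le {f : EuclideanSpace ℝ (Fin n) → ℝ} (hf : ContDiff ℝ 1 f)
    (hs : HasCompactSupport fun x => ‖gradient f x‖) {ε : ℝ} (hε : 0 < ε) :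
    ∃ d : ℝ, 0 < d ∧ ∀ x z, ‖z‖ ≤ d → |f (x + z) - f x - inner ℝ (gradient f x) z| ≤ ε * ‖z‖ := by
  have huc : UniformContinuous (fderiv ℝ f) :=
    (hf.continuous_fderiv (by simp)).uniformContinuous_of_tendsto_cocompact
      (hasCompactSupport_fderiv hs).is_zero_at_infty
  obtain ⟨d, hd, h⟩ := Metric.uniformContinuous_iff.1 huc ε hε
  refine ⟨d / 2, by positivity, fun x z hz => ?_⟩
  have hx : x ∈ Metric.ball x d := Metric.mem_ball_self hd
  have hxz : x + z ∈ Metric.ball x d := by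
    rw [Metric.mem_ball, dist_self_add_left]
    linarith
  have := (convex_ball x d).norm_image_sub_le_of_norm_fderiv_le' (φ := fderiv ℝ f x)
    (C := ε) (fun y _ => (hf.differentiable (by simp)).differentiableAt) (fun y hy => by
      rw [← dist_eq_norm]
      exact (h hy).le) hx hxz
  simpa only [add_sub_cancel_left, ← inner_gradient_left, Real.norm_eq_abs] using this

/-- Uniform continuity of powers, in one-sided form. -/
lemma exists_forall_rpow_le_add {r M η : ℝ} (hr : 0 < r) (hη : 0 < η) :
    ∃ ζ : ℝ, 0 < ζ ∧ ζ ≤ 1 ∧ ∀ s t : ℝ, 0 ≤ s → 0 ≤ t → s ≤ M → t ≤ M → s ≤ t + ζ →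
      s ^ r ≤ t ^ r + η := by
  have hcont : ContinuousOn (fun x : ℝ => x ^ r) (Icc 0 M) :=
    (continuous_id.rpow_const fun _ => Or.inr hr.le).continuousOn
  obtain ⟨ζ, hζ, h⟩ := Metric.uniformContinuousOn_iff.1
    (isCompact_Icc.uniformContinuousOn_of_continuous hcont) η hη
  refine ⟨min (ζ / 2) 1, by positivity, min_le_right _ _, fun s t hs ht hsM htM hst => ?_⟩
  rcases le_total s t with h1 | h1
  · have := Real.rpow_le_rpow hs h1 hr.le
    linarith
  · have h2 := h s ⟨hs, hsM⟩ t ⟨ht, htM⟩ (by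
      rw [Real.dist_eq, abs_of_nonneg (by linarith)]
      have := min_le_left (ζ / 2) 1
      linarith)
    rw [Real.dist_eq] at h2
    have := (abs_lt.1 h2).2
    linarith

/-- The `q`-th power of the difference function, with the factor `l`. -/
noncomputable def differencePower (l γ q : ℝ) (f : EuclideanSpace ℝ (Fin n) → ℝ)
    (x : EuclideanSpace ℝ (Fin n)) : ℝ≥0∞ :=
  ENNReal.ofReal (l ^ q) * ∫⁻ z : EuclideanSpace ℝ (Fin n),
    {z | z ≠ 0 ∧ l * ‖z‖ ^ (1 + γ / q) < |f (x + z) - f x|}.indicator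
      (fun z => ENNReal.ofReal (‖z‖ ^ (γ - n))) z

/-- Translation y = x + z, after which the quotient condition is multiplied out; this is legitimate
since z ≠ 0 on the level set. -/
lemma differencePower_rpow {l γ q : ℝ} (hl : 0 < l) (hq : 0 < q)
    (f : EuclideanSpace ℝ (Fin n) → ℝ) (x : EuclideanSpace ℝ (Fin n)) :
    ENNReal.ofReal l * differenceFunction l γ q f x = differencePower l γ q f x ^ (1 / q) := by
  rw [differencePower, differenceFunction, ENNReal.mul_rpow_of_nonneg _ _ (by positivity),
    ENNReal.ofReal_rpow_of_pos (by positivity), ← Real.rpow_mul hl.le, mul_one_div_cancel hq.ne',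
    Real.rpow_one]
  congr 2
  rw [← lintegral_add_left_eq_self _ x]
  refine lintegral_congr fun z => ?_
  by_cases hz : z = 0
  · simp [hz, levelSet]
  · have hz' : 0 < ‖z‖ := norm_pos_iff.2 hz
    have hiff : (x, x + z) ∈ levelSet l (γ / q) f ↔
        z ∈ {z | z ≠ 0 ∧ l * ‖z‖ ^ (1 + γ / q) < |f (x + z) - f x|} := by
      simp only [levelSet, mem_ofPred_eq, sub_add_cancel_left, norm_neg, ne_eq, left_eq_add,
        hz, not_false_eq_true, true_and]
      rw [lt_div_iff₀ (by positivity), abs_sub_comm]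
    by_cases h : (x, x + z) ∈ levelSet l (γ / q) f
    · rw [indicator_of_mem h, indicator_of_mem (hiff.1 h)]
      simp
    · rw [indicator_of_notMem h, indicator_of_notMem (fun h' => h (hiff.2 h'))]

/-- The contribution of scales larger than `d`. -/
noncomputable def tailPower (n : ℕ) (l γ q d L : ℝ) : ℝ≥0∞ :=
  ENNReal.ofReal (l ^ q) * ∫⁻ z : EuclideanSpace ℝ (Fin n),
    {z | d < ‖z‖ ∧ l * ‖z‖ ^ (1 + γ / q) < L * ‖z‖}.indicator
      (fun z => ENNReal.ofReal (‖z‖ ^ (γ - n))) z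

/-- For γ < 0 the kernel is integrable on |z| > d with a bound independent of l, so the factor l^q
alone gives the limit. -/
lemma tailPower_tendsto_of_neg (hn : 1 ≤ n) {γ q d : ℝ} (hγ : γ < 0) (hq : 0 < q) (hd : 0 < d)
    (L : ℝ) : Tendsto (fun l => tailPower n l γ q d L) (𝓝[>] 0) (𝓝 0) := by
  obtain ⟨K, hK⟩ := lintegral_tail hn hγ
  have h1 : Tendsto (fun l : ℝ => ENNReal.ofReal (l ^ q) * (K * ENNReal.ofReal (d ^ γ)))
      (𝓝[>] 0) (𝓝 0) := by
    have h2 : Tendsto (fun l : ℝ => l ^ q) (𝓝[>] 0) (𝓝 (0 ^ q)) :=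
      ((continuous_id.rpow_const fun _ => Or.inr hq.le).tendsto 0).mono_left nhdsWithin_le_nhds
    rw [Real.zero_rpow hq.ne'] at h2
    have h3 := ENNReal.Tendsto.mul_const (b := (K * ENNReal.ofReal (d ^ γ)))
      (ENNReal.tendsto_ofReal h2)
      (Or.inr (ENNReal.mul_ne_top ENNReal.coe_ne_top ENNReal.ofReal_ne_top))
    simpa using h3
  refine tendsto_of_tendsto_of_tendsto_of_le_of_le tendsto_const_nhds h1 (fun _ => zero_le)
    fun l => ?_
  refine mul_le_mul_right ((lintegral_mono fun z => ?_).trans (hK d hd)) _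
  exact indicator_le_indicator_of_subset (fun z hz => hz.1) (fun _ => zero_le) z

/-- On |z| > d the second condition forces l * d^(γ/q) < L, so the domain is empty as soon as l ≥ L
/ d^(γ/q). -/
lemma tailPower_tendsto_of_pos {γ q d : ℝ} (hγ : 0 < γ) (hq : 0 < q) (hd : 0 < d)
    (L : ℝ) : Tendsto (fun l => tailPower n l γ q d L) atTop (𝓝 0) := by
  refine tendsto_const_nhds.congr' ?_
  filter_upwards [eventually_ge_atTop (L / d ^ (γ / q)), eventually_gt_atTop 0] with l hl hl0
  have : {z : EuclideanSpace ℝ (Fin n) | d < ‖z‖ ∧ l * ‖z‖ ^ (1 + γ / q) < L * ‖z‖} = ∅ := by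
    refine eq_empty_of_forall_notMem fun z hz => ?_
    have hz0 : 0 < ‖z‖ := hd.trans hz.1
    have h2 := hz.2
    rw [Real.rpow_add hz0, Real.rpow_one, mul_left_comm, mul_comm L,
      mul_lt_mul_iff_right₀ hz0] at h2
    rw [div_le_iff₀ (by positivity)] at hl
    have : d ^ (γ / q) ≤ ‖z‖ ^ (γ / q) := Real.rpow_le_rpow hd.le hz.1.le (by positivity)
    have := mul_le_mul_of_nonneg_left this hl0.le
    linarith
  simp [tailPower, this]

/-- The difference function is uniformly close to a multiple of the norm of the gradient, in terms
of `q`-th powers. -/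
lemma exists_forall_differencePower_le (hn : 1 ≤ n) {γ q : ℝ} (hγ : γ ≠ 0) (hq : 0 < q)
    {e : EuclideanSpace ℝ (Fin n)} (he : ‖e‖ = 1) {f : EuclideanSpace ℝ (Fin n) → ℝ}
    (hf : ContDiff ℝ 1 f) (hs : HasCompactSupport fun x => ‖gradient f x‖) {L : ℝ} (hL0 : 0 < L)
    (hL1 : ∀ x, ‖gradient f x‖ ≤ L) (hL2 : ∀ x z, |f (x + z) - f x| ≤ L * ‖z‖) {η : ℝ}
    (hη : 0 < η) :
    ∃ d : ℝ, 0 < d ∧ ∀ l : ℝ, 0 < l → ∀ x,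
      differencePower l γ q f x ≤ ENNReal.ofReal (kappa q e / |γ| * ‖gradient f x‖ ^ q) +
        ENNReal.ofReal η + tailPower n l γ q d L ∧
      ENNReal.ofReal (kappa q e / |γ| * ‖gradient f x‖ ^ q) ≤ differencePower l γ q f x +
        ENNReal.ofReal η + tailPower n l γ q d L := by
  set S := (volume : Measure (EuclideanSpace ℝ (Fin n))).toSphere with hS
  set σ : ℝ := S.real univ with hσ
  have hσ0 : 0 ≤ σ := measureReal_nonneg
  have hγ' : 0 < |γ| := abs_pos.2 hγ
  -- The error in the q-th power is divided by |γ| and integrated over a sphere of mass σ, so this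
  -- choice costs at most η in total. The bound L + 1 leaves room for |v·ω| + ε, as ε ≤ 1.
  obtain ⟨ε, hε, hε1, hpow⟩ := exists_forall_rpow_le_add (r := q) (M := L + 1)
    (η := η * |γ| / (σ + 1)) hq (by positivity)
  obtain ⟨d, hd, htaylor⟩ := exists_forall_abs_sub_inner_le hf hs hε
  have hmodel : ∀ v : EuclideanSpace ℝ (Fin n),
      ∫⁻ ω : Metric.sphere (0 : EuclideanSpace ℝ (Fin n)) 1,
        ENNReal.ofReal (|inner ℝ v (ω : EuclideanSpace ℝ (Fin n))| ^ q / |γ|) ∂S =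
      ENNReal.ofReal (kappa q e / |γ| * ‖v‖ ^ q) := by
    intro v
    have h1 : ∀ ω : Metric.sphere (0 : EuclideanSpace ℝ (Fin n)) 1,
        ENNReal.ofReal (|inner ℝ v (ω : EuclideanSpace ℝ (Fin n))| ^ q / |γ|) =
        ENNReal.ofReal (1 / |γ|) *
          ENNReal.ofReal (|inner ℝ v (ω : EuclideanSpace ℝ (Fin n))| ^ q) := by
      intro ω
      rw [← ENNReal.ofReal_mul (by positivity)]
      congr 1
      ring
    rw [lintegral_congr h1, lintegral_const_mul' _ _ ENNReal.ofReal_ne_top,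
      lintegral_toSphere_inner hn hq he, ← ENNReal.ofReal_mul (by positivity)]
    congr 1
    ring
  have hconst : ∫⁻ _ : Metric.sphere (0 : EuclideanSpace ℝ (Fin n)) 1,
      ENNReal.ofReal (η / (σ + 1)) ∂S ≤ ENNReal.ofReal η := by
    rw [lintegral_const, ← ENNReal.ofReal_toReal (measure_ne_top S univ),
      ← ENNReal.ofReal_mul (by positivity)]
    refine ENNReal.ofReal_le_ofReal ?_
    change η / (σ + 1) * σ ≤ η
    rw [div_mul_eq_mul_div, div_le_iff₀ (by positivity)]
    nlinarith
  have hstep : ∀ a b : ℝ, 0 ≤ a → 0 ≤ b → a ≤ L + 1 → b ≤ L + 1 → a ≤ b + ε →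
      ENNReal.ofReal (a ^ q / |γ|) ≤ ENNReal.ofReal (b ^ q / |γ|) +
        ENNReal.ofReal (η / (σ + 1)) := by
    intro a b ha hb haL hbL hab
    rw [← ENNReal.ofReal_add (by positivity) (by positivity)]
    refine ENNReal.ofReal_le_ofReal ?_
    have := hpow a b ha hb haL hbL hab
    calc a ^ q / |γ| ≤ (b ^ q + η * |γ| / (σ + 1)) / |γ| := by gcongr
      _ = b ^ q / |γ| + η / (σ + 1) := by field_simp
  refine ⟨d, hd, fun l hl x => ?_⟩
  set v := gradient f x with hv
  have hvω : ∀ ω : Metric.sphere (0 : EuclideanSpace ℝ (Fin n)) 1,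
      |inner ℝ v (ω : EuclideanSpace ℝ (Fin n))| ≤ L := by
    intro ω
    refine (abs_real_inner_le_norm _ _).trans ?_
    rw [norm_eq_of_mem_sphere, mul_one]
    exact hL1 x
  have hinner : Measurable fun z => |inner ℝ v z| := by fun_prop
  have hkm := measurable_norm_rpow (n := n) (γ - n)
  have hfc := hf.continuous
  have hDset : MeasurableSet {z : EuclideanSpace ℝ (Fin n) |
      z ≠ 0 ∧ l * ‖z‖ ^ (1 + γ / q) < |f (x + z) - f x|} :=
    (measurableSet_singleton 0).compl.inter (measurableSet_lt (by fun_prop)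
      (by fun_prop : Continuous fun z => |f (x + z) - f x|).measurable)
  have hcover : ∀ s t u : Set (EuclideanSpace ℝ (Fin n)), s ⊆ t ∪ u → MeasurableSet t →
      ENNReal.ofReal (l ^ q) * ∫⁻ z, s.indicator (fun z => ENNReal.ofReal (‖z‖ ^ (γ - n))) z ≤
      ENNReal.ofReal (l ^ q) * (∫⁻ z, t.indicator (fun z => ENNReal.ofReal (‖z‖ ^ (γ - n))) z) +
      ENNReal.ofReal (l ^ q) *
        ∫⁻ z, u.indicator (fun z => ENNReal.ofReal (‖z‖ ^ (γ - n))) z := by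
    intro s t u hstu ht
    rw [← mul_add, ← lintegral_add_left (hkm.indicator ht)]
    refine mul_le_mul_right (lintegral_mono fun z => ?_) _
    refine (indicator_le_indicator_of_subset hstu (fun _ => zero_le) z).trans ?_
    by_cases h1 : z ∈ t
    · exact (indicator_le_self _ _ _).trans (by simp [h1])
    · by_cases h2 : z ∈ u <;> simp [h1, h2]
  constructor
  -- The Taylor error is absorbed without losing homogeneity of degree one, so the model integral
  -- remains exact for every l.
  · set A : EuclideanSpace ℝ (Fin n) → ℝ := fun z => |inner ℝ v z| + ε * ‖z‖ with hA
    have hAm : Measurable A := by fun_prop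
    have hhom := lintegral_homogeneous hn hγ hq hl hAm (fun z => by positivity)
      (fun r hr z => by
        simp only [hA]
        rw [real_inner_smul_right, abs_mul, abs_of_pos hr, norm_smul, Real.norm_of_nonneg hr.le]
        ring)
    refine (hcover _ {z | l * ‖z‖ ^ (1 + γ / q) < A z}
      {z | d < ‖z‖ ∧ l * ‖z‖ ^ (1 + γ / q) < L * ‖z‖} ?_
      (measurableSet_lt (by fun_prop) hAm)).trans ?_
    · rintro z ⟨hz0, hz⟩
      rcases le_or_gt ‖z‖ d with hzd | hzd
      · left
        refine hz.trans_le ?_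
        have h1 := htaylor x z hzd
        have h2 := abs_sub_abs_le_abs_sub (f (x + z) - f x) (inner ℝ v z)
        change _ ≤ |inner ℝ v z| + ε * ‖z‖
        linarith
      · exact Or.inr ⟨hzd, hz.trans_le (hL2 x z)⟩
    · refine add_le_add ?_ le_rfl
      rw [hhom]
      calc ∫⁻ ω : Metric.sphere (0 : EuclideanSpace ℝ (Fin n)) 1,
            ENNReal.ofReal (A ω ^ q / |γ|) ∂S
          ≤ ∫⁻ ω : Metric.sphere (0 : EuclideanSpace ℝ (Fin n)) 1,
            (ENNReal.ofReal (|inner ℝ v (ω : EuclideanSpace ℝ (Fin n))| ^ q / |γ|) +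
              ENNReal.ofReal (η / (σ + 1))) ∂S := by
            refine lintegral_mono fun ω => ?_
            have hω := hvω ω
            have hAω : A ω = |inner ℝ v (ω : EuclideanSpace ℝ (Fin n))| + ε := by
              simp only [hA]
              rw [norm_eq_of_mem_sphere, mul_one]
            rw [hAω]
            exact hstep _ _ (by positivity) (by positivity) (by linarith) (by linarith) le_rfl
        _ ≤ _ := by
            rw [lintegral_add_right _ measurable_const, hmodel]
            gcongr
  -- The positive part meets the nonnegativity required by `lintegral_homogeneous` and does not
  -- enlarge the set, on which A is positive anyway.
  · set A : EuclideanSpace ℝ (Fin n) → ℝ := fun z => max (|inner ℝ v z| - ε * ‖z‖) 0 with hA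
    have hAm : Measurable A := by fun_prop
    have hhom := lintegral_homogeneous hn hγ hq hl hAm (fun z => le_max_right _ _)
      (fun r hr z => by
        simp only [hA]
        rw [real_inner_smul_right, abs_mul, abs_of_pos hr, norm_smul, Real.norm_of_nonneg hr.le,
          mul_max_of_nonneg _ _ hr.le]
        congr 1 <;> ring)
    have hD : ∫⁻ ω : Metric.sphere (0 : EuclideanSpace ℝ (Fin n)) 1,
        ENNReal.ofReal (A ω ^ q / |γ|) ∂S ≤ differencePower l γ q f x + tailPower n l γ q d L := by
      rw [← hhom]
      refine hcover _ _ _ ?_ hDset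
      intro z hz
      have hz : l * ‖z‖ ^ (1 + γ / q) < A z := hz
      have hz0 : 0 < A z := lt_of_le_of_lt (by positivity) hz
      have hAz : A z = |inner ℝ v z| - ε * ‖z‖ := by
        simp only [hA] at hz0 ⊢
        rw [max_eq_left]
        by_contra h
        rw [max_eq_right (not_le.1 h).le] at hz0
        exact lt_irrefl _ hz0
      have hzne : z ≠ 0 := by
        rintro rfl
        rw [hAz] at hz0
        simp at hz0
      rw [hAz] at hz
      rcases le_or_gt ‖z‖ d with hzd | hzd
      · refine Or.inl ⟨hzne, hz.trans_le ?_⟩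
        have h1 := htaylor x z hzd
        have h2 := abs_sub_abs_le_abs_sub (inner ℝ v z) (f (x + z) - f x)
        rw [abs_sub_comm (inner ℝ v z)] at h2
        linarith
      · refine Or.inr ⟨hzd, hz.trans_le ?_⟩
        have h1 := (abs_real_inner_le_norm v z).trans
          (mul_le_mul_of_nonneg_right (hL1 x) (norm_nonneg z))
        have : 0 ≤ ε * ‖z‖ := by positivity
        linarith
    calc ENNReal.ofReal (kappa q e / |γ| * ‖v‖ ^ q)
        = ∫⁻ ω : Metric.sphere (0 : EuclideanSpace ℝ (Fin n)) 1,
          ENNReal.ofReal (|inner ℝ v (ω : EuclideanSpace ℝ (Fin n))| ^ q / |γ|) ∂S :=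
          (hmodel v).symm
      _ ≤ ∫⁻ ω : Metric.sphere (0 : EuclideanSpace ℝ (Fin n)) 1,
            (ENNReal.ofReal (A ω ^ q / |γ|) + ENNReal.ofReal (η / (σ + 1))) ∂S := by
          refine lintegral_mono fun ω => ?_
          have hω := hvω ω
          have hAω : A ω = max (|inner ℝ v (ω : EuclideanSpace ℝ (Fin n))| - ε) 0 := by
            simp only [hA]
            rw [norm_eq_of_mem_sphere, mul_one]
          rw [hAω]
          refine hstep _ _ (by positivity) (le_max_right _ _) (by linarith)
            (max_le (by linarith) (by linarith)) ?_
          linarith [le_max_left (|inner ℝ v (ω : EuclideanSpace ℝ (Fin n))| - ε) 0]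
      _ ≤ (differencePower l γ q f x + tailPower n l γ q d L) + ENNReal.ofReal η := by
          rw [lintegral_add_right _ measurable_const]
          exact add_le_add hD hconst
      _ = _ := by ring

end Uniform

/-! ### From uniform convergence to convergence of norms -/

section Limit

variable {𝕜 : Type*} [RCLike 𝕜] {n : ℕ} {N : (EuclideanSpace ℝ (Fin n) → 𝕜) → ℝ≥0∞}

lemma measurable_differenceFunction {l γ q : ℝ} {f : EuclideanSpace ℝ (Fin n) → ℝ}
    (hf : Continuous f) : Measurable (differenceFunction l γ q f) := by
  have hset : MeasurableSet (levelSet l (γ / q) f) := by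
    refine (measurableSet_eq_fun measurable_fst measurable_snd).compl.inter ?_
    refine measurableSet_lt (f := fun _ => l) measurable_const (Measurable.div (g := fun z :
      EuclideanSpace ℝ (Fin n) × EuclideanSpace ℝ (Fin n) => ‖z.1 - z.2‖ ^ (1 + γ / q)) ?_
      (by fun_prop))
    exact (by fun_prop : Continuous fun z : EuclideanSpace ℝ (Fin n) × EuclideanSpace ℝ (Fin n) =>
      |f z.1 - f z.2|).measurable
  have hm : Measurable ((levelSet l (γ / q) f).indicator
      (fun z => ENNReal.ofReal (‖z.1 - z.2‖ ^ (γ - (n : ℝ))))) :=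
    Measurable.indicator (by fun_prop) hset
  exact hm.lintegral_prod_right'.pow_const _

/-- The difference function converges uniformly to a multiple of the norm of the gradient. -/
lemma eventually_forall_differenceFunction_le (hn : 1 ≤ n) {γ q : ℝ} (hγ : γ ≠ 0) (hq : 0 < q)
    {e : EuclideanSpace ℝ (Fin n)} (he : ‖e‖ = 1) {f : EuclideanSpace ℝ (Fin n) → ℝ}
    (hf : ContDiff ℝ 1 f) (hs : HasCompactSupport fun x => ‖gradient f x‖) {F : Filter ℝ}
    (hF : ∀ᶠ l in F, 0 < l)
    (htail : ∀ d L : ℝ, 0 < d → Tendsto (fun l => tailPower n l γ q d L) F (𝓝 0))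
    {η : ℝ} (hη : 0 < η) :
    ∀ᶠ l in F, ∀ x,
      ENNReal.ofReal l * differenceFunction l γ q f x ≤
        ENNReal.ofReal ((kappa q e / |γ|) ^ (1 / q) * ‖gradient f x‖) + ENNReal.ofReal η ∧
      ENNReal.ofReal ((kappa q e / |γ|) ^ (1 / q) * ‖gradient f x‖) ≤
        ENNReal.ofReal l * differenceFunction l γ q f x + ENNReal.ofReal η := by
  obtain ⟨L, hL0, hL1, hL2⟩ := exists_bound_gradient hf hs
  have hκ := kappa_nonneg q e
  -- The comparison of q-th powers will have error ζ ≤ 1, half from the Taylor estimate and half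
  -- from the tail, so both sides stay below this M when the root is taken.
  obtain ⟨ζ, hζ, hζ1, hpow⟩ := exists_forall_rpow_le_add (r := 1 / q)
    (M := kappa q e / |γ| * L ^ q + 1) (by positivity) hη
  obtain ⟨d, hd, h⟩ := exists_forall_differencePower_le hn hγ hq he hf hs hL0 hL1 hL2
    (half_pos hζ)
  have hζ2 : (0 : ℝ≥0∞) < ENNReal.ofReal (ζ / 2) := by simpa using hζ
  filter_upwards [hF, (htail d L hd).eventually (eventually_le_nhds hζ2)] with l hl hT x
  set a : ℝ := kappa q e / |γ| * ‖gradient f x‖ ^ q with ha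
  have ha0 : 0 ≤ a := by positivity
  have haM : a ≤ kappa q e / |γ| * L ^ q := by
    have := hL1 x
    rw [ha]
    gcongr
  have haq : a ^ (1 / q) = (kappa q e / |γ|) ^ (1 / q) * ‖gradient f x‖ := by
    rw [ha, Real.mul_rpow (by positivity) (by positivity), ← Real.rpow_mul (norm_nonneg _),
      mul_one_div_cancel hq.ne', Real.rpow_one]
  have hsum : ENNReal.ofReal (ζ / 2) + ENNReal.ofReal (ζ / 2) = ENNReal.ofReal ζ := by
    rw [← ENNReal.ofReal_add (by positivity) (by positivity), add_halves]
  obtain ⟨h1, h2⟩ := h l hl x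
  have h1' : differencePower l γ q f x ≤ ENNReal.ofReal a + ENNReal.ofReal ζ := by
    refine h1.trans ?_
    rw [← hsum, ← add_assoc]
    gcongr
  have h2' : ENNReal.ofReal a ≤ differencePower l γ q f x + ENNReal.ofReal ζ := by
    refine h2.trans ?_
    rw [← hsum, ← add_assoc]
    gcongr
  have hfin : differencePower l γ q f x ≠ ∞ :=
    ne_top_of_le_ne_top (ENNReal.add_ne_top.2 ⟨ENNReal.ofReal_ne_top, ENNReal.ofReal_ne_top⟩) h1'
  rw [differencePower_rpow hl hq, ← haq]
  set t : ℝ := (differencePower l γ q f x).toReal with ht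
  have ht0 : 0 ≤ t := ENNReal.toReal_nonneg
  have htD : differencePower l γ q f x = ENNReal.ofReal t := (ENNReal.ofReal_toReal hfin).symm
  rw [htD, ← ENNReal.ofReal_add ha0 hζ.le, ENNReal.ofReal_le_ofReal_iff (by positivity)] at h1'
  rw [htD, ← ENNReal.ofReal_add ht0 hζ.le, ENNReal.ofReal_le_ofReal_iff (by positivity)] at h2'
  rw [htD, ENNReal.ofReal_rpow_of_nonneg ht0 (by positivity),
    ← ENNReal.ofReal_add (by positivity) hη.le, ← ENNReal.ofReal_add (by positivity) hη.le]
  exact ⟨ENNReal.ofReal_le_ofReal (hpow _ _ ht0 ha0 (by linarith) (by linarith) h1'),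
    ENNReal.ofReal_le_ofReal (hpow _ _ ha0 ht0 (by linarith) (by linarith) h2')⟩

/-- Uniform convergence on a ball and control off the ball give convergence of the functional. -/
lemma IsBallBanachFunctionSpace.tendsto_bvyFunctional (hN : IsBallBanachFunctionSpace N)
    (hn : 1 ≤ n) {γ q : ℝ} (hγ : γ ≠ 0) (hq : 0 < q)
    {e : EuclideanSpace ℝ (Fin n)} (he : ‖e‖ = 1) {f : EuclideanSpace ℝ (Fin n) → ℝ}
    (hf : ContDiff ℝ 1 f) (hs : HasCompactSupport fun x => ‖gradient f x‖) {F : Filter ℝ}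
    (hF : ∀ᶠ l in F, 0 < l)
    (htail : ∀ d L : ℝ, 0 < d → Tendsto (fun l => tailPower n l γ q d L) F (𝓝 0))
    {R : ℝ} (hR : ∀ x ∉ Metric.ball 0 R, gradient f x = 0)
    {w : EuclideanSpace ℝ (Fin n) → ℝ≥0∞} (hwm : Measurable w) (hwt : ∀ x, w x ≠ ∞)
    (hw : extNorm N w < ∞) {r : ℝ → ℝ≥0} (hr : Tendsto r F (𝓝 0))
    (hout : ∀ᶠ l in F, ∀ x ∉ Metric.ball 0 R,
      ENNReal.ofReal l * differenceFunction l γ q f x ≤ r l * w x) :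
    Tendsto (bvyFunctional N γ q f) F
      (𝓝 (ENNReal.ofReal ((kappa q e / |γ|) ^ (1 / q)) *
        N (fun x => ((‖gradient f x‖ : ℝ) : 𝕜)))) := by
  have hκ := kappa_nonneg q e
  set c : ℝ := (kappa q e / |γ|) ^ (1 / q) with hc
  have hc0 : 0 ≤ c := by positivity
  obtain ⟨L, hL0, hL1, -⟩ := exists_bound_gradient hf hs
  have hgrad : Continuous fun x => ‖gradient f x‖ := by
    simp only [← norm_fderiv_eq_norm_gradient]
    exact (hf.continuous_fderiv (by simp)).norm
  have hgm : Measurable fun x => ENNReal.ofReal (c * ‖gradient f x‖) :=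
    (hgrad.measurable.const_mul c).ennreal_ofReal
  have hbm : Measurable ((Metric.ball (0 : EuclideanSpace ℝ (Fin n)) R).indicator
      (fun _ => (1 : ℝ≥0∞))) := measurable_const.indicator measurableSet_ball
  have hbt : ∀ x, (Metric.ball (0 : EuclideanSpace ℝ (Fin n)) R).indicator
      (fun _ => (1 : ℝ≥0∞)) x ≠ ∞ := fun x => by
    by_cases hx : x ∈ Metric.ball (0 : EuclideanSpace ℝ (Fin n)) R <;> simp [hx]
  have hK := hN.extNorm_indicator_ball_lt_top 0 R
  set K := extNorm N ((Metric.ball (0 : EuclideanSpace ℝ (Fin n)) R).indicator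
      (fun _ => (1 : ℝ≥0∞))) with hKdef
  set G := extNorm N (fun x => ENNReal.ofReal (c * ‖gradient f x‖)) with hG
  have hlim : ENNReal.ofReal c * N (fun x => ((‖gradient f x‖ : ℝ) : 𝕜)) = G := by
    rw [hN.norm_eq_extNorm (f := fun x => ((‖gradient f x‖ : ℝ) : 𝕜))
      (RCLike.measurable_ofReal.comp hgrad.measurable).aemeasurable]
    have h1 := hN.extNorm_const_mul c.toNNReal
      (u := fun x => ‖((‖gradient f x‖ : ℝ) : 𝕜)‖ₑ)
      (RCLike.measurable_ofReal.comp hgrad.measurable).enorm.aemeasurable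
      (Or.inr (ae_of_all _ fun x => enorm_ne_top))
    rw [ENNReal.ofReal, ← h1, hG]
    congr 1
    ext x
    rw [ENNReal.ofReal_mul hc0, ← ofReal_norm]
    simp [ENNReal.ofReal]
  have hGt : G ≠ ∞ := by
    refine (lt_of_le_of_lt (hN.extNorm_mono hgm.aemeasurable (hbm.const_mul
      ((c * L).toNNReal : ℝ≥0∞)).aemeasurable (ae_of_all _ fun x => ?_)) ?_).ne
    · by_cases hx : x ∈ Metric.ball (0 : EuclideanSpace ℝ (Fin n)) R
      · rw [indicator_of_mem hx, mul_one]
        exact ENNReal.ofReal_le_ofReal (mul_le_mul_of_nonneg_left (hL1 x) hc0)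
      · simp [hR x hx]
    · rw [hN.extNorm_const_mul _ hbm.aemeasurable (Or.inr (ae_of_all _ hbt))]
      exact ENNReal.mul_lt_top ENNReal.coe_lt_top hK
  rw [hlim, ENNReal.tendsto_nhds hGt]
  intro ε hε
  have hε2 : ε / 2 ≠ 0 := (ENNReal.half_pos hε.ne').ne'
  obtain ⟨η, hη, hηK⟩ := ENNReal.exists_nnreal_pos_mul_lt hK.ne hε2
  have hrw : Tendsto (fun l => (r l : ℝ≥0∞) * extNorm N w) F (𝓝 0) := by
    have := ENNReal.Tendsto.mul_const (b := extNorm N w) (ENNReal.tendsto_coe.2 hr)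
      (Or.inr hw.ne)
    simpa using this
  filter_upwards [hF, hout, hrw.eventually (eventually_le_nhds (pos_iff_ne_zero.2 hε2)),
    eventually_forall_differenceFunction_le hn hγ hq he hf hs hF htail
      (η := η) (by exact_mod_cast hη)] with l hl h1 h2 h3
  have hhm : Measurable fun x => ENNReal.ofReal l * differenceFunction l γ q f x :=
    (measurable_differenceFunction hf.continuous).const_mul _
  have hbvy : bvyFunctional N γ q f l =
      extNorm N (fun x => ENNReal.ofReal l * differenceFunction l γ q f x) := by
    rw [bvyFunctional, ENNReal.ofReal]
    exact (hN.extNorm_const_mul _ (measurable_differenceFunction hf.continuous).aemeasurable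
      (Or.inl (by simpa using hl))).symm
  have hηb : extNorm N (fun x => η * (Metric.ball (0 : EuclideanSpace ℝ (Fin n)) R).indicator
      (fun _ => (1 : ℝ≥0∞)) x) = η * K :=
    hN.extNorm_const_mul _ hbm.aemeasurable (Or.inr (ae_of_all _ hbt))
  rw [hbvy]
  -- The lower bound needs nothing off the ball, where the gradient vanishes; only the upper bound
  -- uses w.
  constructor
  · rw [tsub_le_iff_right]
    calc G ≤ extNorm N (fun x => ENNReal.ofReal l * differenceFunction l γ q f x +
          η * (Metric.ball (0 : EuclideanSpace ℝ (Fin n)) R).indicator (fun _ => (1 : ℝ≥0∞)) x) := by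
          refine hN.extNorm_mono hgm.aemeasurable (hhm.add (hbm.const_mul _)).aemeasurable
            (ae_of_all _ fun x => ?_)
          by_cases hx : x ∈ Metric.ball (0 : EuclideanSpace ℝ (Fin n)) R
          · rw [indicator_of_mem hx, mul_one, ← ENNReal.ofReal_coe_nnreal]
            exact (h3 x).2
          · simp [hR x hx]
      _ ≤ _ := hN.extNorm_add_le hhm.aemeasurable (hbm.const_mul _).aemeasurable
      _ ≤ _ := by
          rw [hηb]
          gcongr
          exact hηK.le.trans ENNReal.half_le_self
  · calc extNorm N (fun x => ENNReal.ofReal l * differenceFunction l γ q f x)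
        ≤ extNorm N (fun x => ENNReal.ofReal (c * ‖gradient f x‖) +
          (η * (Metric.ball (0 : EuclideanSpace ℝ (Fin n)) R).indicator (fun _ => (1 : ℝ≥0∞)) x
            + r l * w x)) := by
          refine hN.extNorm_mono hhm.aemeasurable (hgm.add ((hbm.const_mul _).add
            (hwm.const_mul _))).aemeasurable (ae_of_all _ fun x => ?_)
          by_cases hx : x ∈ Metric.ball (0 : EuclideanSpace ℝ (Fin n)) R
          · rw [indicator_of_mem hx, mul_one, ← ENNReal.ofReal_coe_nnreal, ← add_assoc]
            exact (h3 x).1.trans le_self_add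
          · exact (h1 x hx).trans (by rw [← add_assoc]; exact le_add_self)
      _ ≤ G + extNorm N (fun x =>
            η * (Metric.ball (0 : EuclideanSpace ℝ (Fin n)) R).indicator (fun _ => (1 : ℝ≥0∞)) x
            + r l * w x) :=
          hN.extNorm_add_le hgm.aemeasurable
            ((hbm.const_mul _).add (hwm.const_mul _)).aemeasurable
      _ ≤ G + (η * K + r l * extNorm N w) := by
          gcongr
          refine (hN.extNorm_add_le (hbm.const_mul _).aemeasurable
            (hwm.const_mul _).aemeasurable).trans ?_
          rw [hηb, hN.extNorm_const_mul _ hwm.aemeasurable (Or.inr (ae_of_all _ hwt))]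
      _ ≤ G + (ε / 2 + ε / 2) := by gcongr
      _ = G + ε := by rw [ENNReal.add_halves]

end Limit

/-! ### Decay away from the support of the gradient -/

section Exterior

variable {𝕜 : Type*} [RCLike 𝕜] {n : ℕ} {N : (EuclideanSpace ℝ (Fin n) → 𝕜) → ℝ≥0∞}

lemma exists_gradient_eq_zero {f : EuclideanSpace ℝ (Fin n) → ℝ}
    (hs : HasCompactSupport fun x => ‖gradient f x‖) :
    ∃ R : ℝ, 1 ≤ R ∧ ∀ x, R < ‖x‖ → gradient f x = 0 := by
  obtain ⟨R, hR⟩ := hs.isCompact.isBounded.subset_closedBall 0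
  refine ⟨max R 1, le_max_right _ _, fun x hx => ?_⟩
  by_contra h
  have h1 : x ∈ Metric.closedBall (0 : EuclideanSpace ℝ (Fin n)) R :=
    hR (subset_tsupport _ (by simpa using h))
  rw [mem_closedBall_zero_iff] at h1
  exact absurd (hx.trans_le h1) (not_lt.2 (le_max_left _ _))

lemma eq_of_gradient_eq_zero {f : EuclideanSpace ℝ (Fin n) → ℝ} (hf : ContDiff ℝ 1 f)
    {s : Set (EuclideanSpace ℝ (Fin n))} (hs : IsOpen s) (hs' : IsPreconnected s)
    (h : ∀ x ∈ s, gradient f x = 0) {x y : EuclideanSpace ℝ (Fin n)} (hx : x ∈ s) (hy : y ∈ s) :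
    f x = f y := by
  refine hs.is_const_of_fderiv_eq_zero (𝕜 := ℝ) hs' (hf.differentiable (by simp)).differentiableOn
    (fun z hz => ?_) hx hy
  rw [Pi.zero_apply, ← norm_eq_zero, norm_fderiv_eq_norm_gradient, h z hz, norm_zero]

/-- The exterior is the image of (R, ∞) × sphere under scaling, and the unit sphere is connected in
dimension at least 2. -/
lemma isPreconnected_exterior (hn : 2 ≤ n) {R : ℝ} (hR : 0 ≤ R) :
    IsPreconnected {x : EuclideanSpace ℝ (Fin n) | R < ‖x‖} := by
  have hrank : 1 < Module.rank ℝ (EuclideanSpace ℝ (Fin n)) :=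
    Module.lt_rank_of_lt_finrank (by rw [finrank_euclideanSpace_fin]; omega)
  have h := ((isPreconnected_Ioi (a := R)).prod (isPreconnected_sphere hrank 0 1)).image
    (fun p : ℝ × EuclideanSpace ℝ (Fin n) => p.1 • p.2) (by fun_prop)
  convert h using 1
  ext x
  simp only [mem_ofPred_eq, mem_image, mem_prod, mem_Ioi, mem_sphere_zero_iff_norm, Prod.exists]
  constructor
  · intro hx
    have hx0 : ‖x‖ ≠ 0 := (hR.trans_lt hx).ne'
    exact ⟨‖x‖, ‖x‖⁻¹ • x, ⟨hx, by simp [norm_smul, hx0]⟩, by simp [smul_smul, hx0]⟩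
  · rintro ⟨r, ω, ⟨hr, hω⟩, rfl⟩
    rwa [norm_smul, hω, mul_one, Real.norm_of_nonneg (hR.trans hr.le)]

/-- Off the support of the gradient, `f` is locally constant at scale half the norm. -/
lemma half_norm_le_of_ne {f : EuclideanSpace ℝ (Fin n) → ℝ} (hf : ContDiff ℝ 1 f) {R : ℝ}
    (hR : ∀ x, R < ‖x‖ → gradient f x = 0) {ρ : ℝ}
    {x z : EuclideanSpace ℝ (Fin n)} (hx : R + ρ ≤ ‖x‖) (hz : f (x + z) ≠ f x) : ρ ≤ ‖z‖ := by
  by_contra h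
  rw [not_le] at h
  have hρ : 0 < ρ := (norm_nonneg z).trans_lt h
  refine hz (eq_of_gradient_eq_zero hf Metric.isOpen_ball (convex_ball x ρ).isPreconnected
    (fun y hy => hR y ?_) (by simpa using h) (Metric.mem_ball_self hρ))
  rw [Metric.mem_ball, dist_eq_norm, norm_sub_rev] at hy
  have := norm_sub_norm_le x y
  linarith

/-- The kernel integrated over the points where `f` takes another value than at `x`. -/
noncomputable def jumpIntegral (γ : ℝ) (f : EuclideanSpace ℝ (Fin n) → ℝ)
    (x : EuclideanSpace ℝ (Fin n)) : ℝ≥0∞ :=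
  ∫⁻ z : EuclideanSpace ℝ (Fin n), {z | f (x + z) ≠ f x}.indicator
    (fun z => ENNReal.ofReal (‖z‖ ^ (γ - n))) z

/-- Since f is constant on the ball of radius |x|/2 about x, only the tail of the kernel
contributes. This is the estimate for n = 1, where f may have different constant values near the two
ends. -/
lemma jumpIntegral_le_of_gradient (hn : 1 ≤ n) {γ : ℝ} (hγ : γ < 0)
    {f : EuclideanSpace ℝ (Fin n) → ℝ} (hf : ContDiff ℝ 1 f) {R : ℝ} (hR1 : 1 ≤ R)
    (hR : ∀ x, R < ‖x‖ → gradient f x = 0) :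
    ∃ C : ℝ≥0, ∀ x, 2 * R ≤ ‖x‖ → jumpIntegral γ f x ≤ C * ENNReal.ofReal (‖x‖ ^ (-(-γ))) := by
  obtain ⟨K, hK⟩ := lintegral_tail hn hγ
  refine ⟨K * (3 ^ (-γ) : ℝ).toNNReal, fun x hx => ?_⟩
  have hx0 : 0 < ‖x‖ := by linarith
  -- A third instead of a half, because the tail estimate is over a strict inequality.
  refine ((lintegral_mono fun z => ?_).trans (hK (‖x‖ / 3) (by positivity))).trans (le_of_eq ?_)
  · refine indicator_le_indicator_of_subset (fun z hz => ?_) (fun _ => zero_le) z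
    have h := half_norm_le_of_ne hf hR (ρ := ‖x‖ / 2) (by linarith) hz
    change ‖x‖ / 3 < ‖z‖
    linarith
  · rw [ENNReal.coe_mul, mul_assoc, ← ENNReal.ofReal, ← ENNReal.ofReal_mul (by positivity),
      neg_neg, Real.div_rpow hx0.le (by norm_num), Real.rpow_neg (by norm_num)]
    congr 2
    ring

/-- With a common value near infinity, f(x + z) ≠ f(x) confines x + z to a fixed ball. There |z| ≥
|x|/2, and the fixed volume gains a factor |x|^(-n) over the general estimate. -/
lemma jumpIntegral_le_of_const {γ : ℝ} (hγ : γ < 0)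
    {f : EuclideanSpace ℝ (Fin n) → ℝ} {R b : ℝ} (hR1 : 1 ≤ R) (hR : ∀ x, R < ‖x‖ → f x = b) :
    ∃ C : ℝ≥0, ∀ x, 2 * R ≤ ‖x‖ → jumpIntegral γ f x ≤ C * ENNReal.ofReal (‖x‖ ^ (-(n - γ))) := by
  set V := volume (Metric.closedBall (0 : EuclideanSpace ℝ (Fin n)) R) with hV
  have hVt : V ≠ ∞ := measure_closedBall_lt_top.ne
  refine ⟨V.toNNReal * (2 ^ (n - γ) : ℝ).toNNReal, fun x hx => ?_⟩
  have hx0 : 0 < ‖x‖ := by linarith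
  have hn0 : (0 : ℝ) ≤ n := by positivity
  have h1 : jumpIntegral γ f x ≤ ∫⁻ z, (Metric.closedBall (-x) R).indicator
      (fun _ => ENNReal.ofReal ((‖x‖ / 2) ^ (γ - n))) z := by
    refine lintegral_mono fun z => ?_
    by_cases hz : f (x + z) = f x
    · rw [indicator_of_notMem (by simpa using hz)]
      exact zero_le
    · have h2 : ‖x + z‖ ≤ R := by
        by_contra h
        exact hz ((hR _ (not_le.1 h)).trans (hR x (by linarith)).symm)
      have h3 : z ∈ Metric.closedBall (-x) R := by
        rwa [Metric.mem_closedBall, dist_eq_norm, sub_neg_eq_add, add_comm]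
      rw [indicator_of_mem (show z ∈ {z | f (x + z) ≠ f x} from hz), indicator_of_mem h3]
      refine ENNReal.ofReal_le_ofReal
        (Real.rpow_le_rpow_of_nonpos (by positivity) ?_ (by linarith))
      have h4 : ‖x‖ ≤ ‖x + z‖ + ‖z‖ := by
        simpa using norm_sub_le (x + z) z
      linarith
  refine h1.trans (le_of_eq ?_)
  rw [lintegral_indicator measurableSet_closedBall, setLIntegral_const,
    Measure.addHaar_closedBall_center, ← hV, ENNReal.coe_mul, ENNReal.coe_toNNReal hVt, mul_assoc,
    ← ENNReal.ofReal, ← ENNReal.ofReal_mul (by positivity), mul_comm, neg_sub,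
    Real.div_rpow hx0.le (by norm_num), ← neg_sub γ (n : ℝ), Real.rpow_neg (by norm_num)]
  congr 2
  ring

/-- The limit `l → 0`, given a decay estimate at infinity. -/
lemma IsBallBanachFunctionSpace.tendsto_bvyFunctional_of_decay (hN : IsBallBanachFunctionSpace N)
    (hn : 1 ≤ n) {p γ q : ℝ} (hp : 0 < p) (hγ : γ < 0) (hq : 0 < q)
    (hY : IsBallBanachFunctionSpace (convexificationNorm N (1 / p)))
    (hM : HLMaximalBoundedOn (associateNorm (convexificationNorm N (1 / p))))
    {e : EuclideanSpace ℝ (Fin n)} (he : ‖e‖ = 1) {f : EuclideanSpace ℝ (Fin n) → ℝ}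
    (hf : ContDiff ℝ 1 f) (hs : HasCompactSupport fun x => ‖gradient f x‖) {R a : ℝ} (hR1 : 1 ≤ R)
    (hR : ∀ x, R < ‖x‖ → gradient f x = 0) (ha : n / p < a / q) {C : ℝ≥0}
    (hC : ∀ x, 2 * R ≤ ‖x‖ → jumpIntegral γ f x ≤ C * ENNReal.ofReal (‖x‖ ^ (-a))) :
    Tendsto (bvyFunctional N γ q f) (𝓝[>] 0)
      (𝓝 (ENNReal.ofReal ((-(kappa q e / γ)) ^ (1 / q)) *
        N (fun x => ((‖gradient f x‖ : ℝ) : 𝕜)))) := by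
  obtain ⟨K, hK⟩ := hN.exists_extNorm_indicator_ball_le_rpow hp hY hM
  have haq : 0 ≤ a / q := le_trans (by positivity) ha.le
  have hw := hN.extNorm_indicator_rpow_lt_top ha haq hK
  set u : EuclideanSpace ℝ (Fin n) → ℝ≥0∞ :=
    ({x | 1 ≤ ‖x‖} : Set (EuclideanSpace ℝ (Fin n))).indicator
      (fun x => ENNReal.ofReal (‖x‖ ^ (-(a / q)))) with hu
  have hum : Measurable u :=
    Measurable.indicator (by fun_prop) (measurableSet_le measurable_const measurable_norm)
  have hut : ∀ x, u x ≠ ∞ := fun x => by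
    by_cases hx : 1 ≤ ‖x‖ <;> simp [hu, hx]
  have hF : ∀ᶠ l : ℝ in 𝓝[>] 0, 0 < l := self_mem_nhdsWithin
  have hr : Tendsto (fun l : ℝ => l.toNNReal) (𝓝[>] 0) (𝓝 0) := by
    have := (continuous_real_toNNReal.tendsto 0).mono_left (nhdsWithin_le_nhds (s := Ioi 0))
    rwa [Real.toNNReal_zero] at this
  rw [← div_neg, ← abs_of_neg hγ]
  refine hN.tendsto_bvyFunctional hn hγ.ne hq he hf hs hF
    (fun d L hd => tailPower_tendsto_of_neg hn hγ hq hd L) (R := 2 * R)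
    (fun x hx => hR x ?_) (w := fun x => (C ^ (1 / q) : ℝ≥0) * u x) (hum.const_mul _)
    (fun x => ENNReal.mul_ne_top ENNReal.coe_ne_top (hut x)) ?_ hr ?_
  · rw [mem_ball_zero_iff] at hx
    linarith
  · rw [hN.extNorm_const_mul _ hum.aemeasurable (Or.inr (ae_of_all _ hut))]
    exact ENNReal.mul_lt_top ENNReal.coe_lt_top hw
  · filter_upwards [hF] with l hl x hx
    rw [mem_ball_zero_iff, not_lt] at hx
    have hx0 : 0 < ‖x‖ := by linarith
    have hx1 : x ∈ {x : EuclideanSpace ℝ (Fin n) | 1 ≤ ‖x‖} := by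
      change 1 ≤ ‖x‖
      linarith
    -- The level set lies in the set where f changes value, whatever l is; after the q-th root the
    -- dependence on l is the single factor l, which is the rate r.
    have h1 : differencePower l γ q f x ≤ ENNReal.ofReal (l ^ q) *
        (C * ENNReal.ofReal (‖x‖ ^ (-a))) := by
      refine mul_le_mul_right (le_trans (lintegral_mono fun z => ?_) (hC x hx)) _
      refine indicator_le_indicator_of_subset (fun z hz hfz => ?_) (fun _ => zero_le) z
      have h2 := hz.2
      rw [hfz, sub_self, abs_zero] at h2
      exact absurd h2 (not_lt.2 (by positivity))
    rw [differencePower_rpow hl hq, hu, indicator_of_mem hx1]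
    refine (ENNReal.rpow_le_rpow h1 (by positivity)).trans (le_of_eq ?_)
    rw [ENNReal.mul_rpow_of_nonneg _ _ (by positivity), ENNReal.mul_rpow_of_nonneg _ _
      (by positivity), ENNReal.ofReal_rpow_of_pos (by positivity),
      ENNReal.ofReal_rpow_of_pos (by positivity), ← Real.rpow_mul hl.le, ← Real.rpow_mul hx0.le,
      mul_one_div_cancel hq.ne', Real.rpow_one, ENNReal.coe_rpow_of_nonneg _ (by positivity),
      mul_one_div, neg_div]
    rfl

end Exterior

/-! ### The limiting identities -/

theorem mainTheorem7 {𝕜 : Type*} [RCLike 𝕜] (n : ℕ) (hn : 1 ≤ n)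
    (N : (EuclideanSpace ℝ (Fin n) → 𝕜) → ℝ≥0∞) (hN : IsBallBanachFunctionSpace N)
    (e : EuclideanSpace ℝ (Fin n)) (he : ‖e‖ = 1) :
    (∀ γ q : ℝ, 0 < γ → 0 < q →
      ∀ f : EuclideanSpace ℝ (Fin n) → ℝ, ContDiff ℝ 1 f →
        HasCompactSupport (fun x => ‖gradient f x‖) →
        Tendsto (bvyFunctional N γ q f) atTop
          (𝓝 (ENNReal.ofReal ((kappa q e / γ) ^ (1 / q)) *
            N (fun x => ((‖gradient f x‖ : ℝ) : 𝕜))))) ∧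
    (∀ p γ q : ℝ, 1 ≤ p → γ < 0 → 0 < q → q < ((n : ℝ) - γ) / n * p →
      IsBallBanachFunctionSpace (convexificationNorm N (1 / p)) →
      HLMaximalBoundedOn (associateNorm (convexificationNorm N (1 / p))) →
      (∀ f : EuclideanSpace ℝ (Fin n) → ℝ, ContDiff ℝ 1 f → HasCompactSupport f →
        Tendsto (bvyFunctional N γ q f) (𝓝[>] 0)
          (𝓝 (ENNReal.ofReal ((-(kappa q e / γ)) ^ (1 / q)) *
            N (fun x => ((‖gradient f x‖ : ℝ) : 𝕜))))) ∧
      ((2 ≤ n ∨ (n = 1 ∧ q < -(p * γ))) →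
        ∀ f : EuclideanSpace ℝ (Fin n) → ℝ, ContDiff ℝ 1 f →
          HasCompactSupport (fun x => ‖gradient f x‖) →
          Tendsto (bvyFunctional N γ q f) (𝓝[>] 0)
            (𝓝 (ENNReal.ofReal ((-(kappa q e / γ)) ^ (1 / q)) *
              N (fun x => ((‖gradient f x‖ : ℝ) : 𝕜)))))) := by
  refine ⟨fun γ q hγ hq f hf hs => ?_, fun p γ q hp hγ hq hqp hY hM => ?_⟩
  · obtain ⟨R, hR1, hR⟩ := exists_gradient_eq_zero hs
    obtain ⟨L, hL0, -, hL2⟩ := exists_bound_gradient hf hs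
    have hF : ∀ᶠ l : ℝ in atTop, 0 < l := eventually_gt_atTop 0
    have h0 : extNorm N (fun _ => 0) < ∞ := by
      have h1 := hN.extNorm_const_mul 0 (u := fun _ => 0) aemeasurable_const (Or.inr (by simp))
      simp only [ENNReal.coe_zero, zero_mul] at h1
      rw [h1]
      exact ENNReal.zero_lt_top
    -- Outside the ball of radius R + 1, f is constant on the unit ball about x, so a change of
    -- value needs |z| ≥ 1. For l ≥ L this contradicts the Lipschitz bound, and w = 0 suffices.
    have hlim := hN.tendsto_bvyFunctional hn hγ.ne' hq he hf hs hF
      (fun d L hd => tailPower_tendsto_of_pos hγ hq hd L) (R := R + 1)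
      (fun x hx => hR x (by rw [mem_ball_zero_iff] at hx; linarith)) (w := fun _ => 0)
      measurable_const (fun _ => ENNReal.zero_ne_top) h0 (r := fun _ => 0) tendsto_const_nhds ?_
    · rwa [abs_of_pos hγ] at hlim
    · filter_upwards [hF, eventually_ge_atTop L] with l hl hlL x hx
      rw [mem_ball_zero_iff, not_lt] at hx
      have hempty : {z | z ≠ 0 ∧ l * ‖z‖ ^ (1 + γ / q) < |f (x + z) - f x|} = ∅ := by
        refine eq_empty_of_forall_notMem fun z hz => ?_
        have hz2 := hz.2
        have hfz : f (x + z) ≠ f x := by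
          intro h
          rw [h, sub_self, abs_zero] at hz2
          exact absurd hz2 (not_lt.2 (by positivity))
        have hz1 : 1 ≤ ‖z‖ := half_norm_le_of_ne hf hR hx hfz
        have h3 : ‖z‖ ≤ ‖z‖ ^ (1 + γ / q) := by
          refine Real.self_le_rpow_of_one_le hz1 ?_
          have : 0 ≤ γ / q := by positivity
          linarith
        have h4 := hz2.trans_le (hL2 x z)
        have h5 : L * ‖z‖ ≤ l * ‖z‖ ^ (1 + γ / q) := by gcongr
        linarith
      rw [differencePower_rpow hl hq, differencePower, hempty]
      simp [hq]
  · have hp0 : 0 < p := by linarith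
    have hn0 : (0 : ℝ) < n := by exact_mod_cast hn
    -- The hypothesis on q, rewritten as the decay condition for a = n - γ.
    have hdecay : (n : ℝ) / p < (n - γ) / q := by
      rw [div_lt_div_iff₀ hp0 hq]
      rw [div_mul_eq_mul_div, lt_div_iff₀ hn0] at hqp
      linarith
    refine ⟨fun f hf hsf => ?_, fun hcase f hf hs => ?_⟩
    · have hs : HasCompactSupport fun x => ‖gradient f x‖ := by
        simpa only [norm_fderiv_eq_norm_gradient] using (hsf.fderiv (𝕜 := ℝ)).norm
      obtain ⟨R, hR1, hR⟩ := exists_gradient_eq_zero hs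
      obtain ⟨R', hR'⟩ := hsf.isCompact.isBounded.subset_closedBall 0
      have hout : ∀ x, max R R' < ‖x‖ → f x = 0 := by
        intro x hx
        by_contra h
        have h1 := hR' (subset_tsupport _ (Function.mem_support.2 h))
        rw [mem_closedBall_zero_iff] at h1
        exact absurd ((le_max_right R R').trans_lt hx) (not_lt.2 h1)
      obtain ⟨C, hC⟩ := jumpIntegral_le_of_const hγ (hR1.trans (le_max_left R R')) hout
      exact hN.tendsto_bvyFunctional_of_decay hn hp0 hγ hq hY hM he hf hs
        (hR1.trans (le_max_left R R')) (fun x hx => hR x ((le_max_left _ _).trans_lt hx)) hdecay hC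
    · obtain ⟨R, hR1, hR⟩ := exists_gradient_eq_zero hs
      rcases hcase with hn2 | ⟨rfl, hq1⟩
      · have : NeZero n := ⟨by omega⟩
        have hopen : IsOpen {x : EuclideanSpace ℝ (Fin n) | R < ‖x‖} :=
          isOpen_lt continuous_const continuous_norm
        have hmem : R < ‖(R + 1) • e‖ := by
          rw [norm_smul, he, mul_one, Real.norm_of_nonneg (by linarith)]
          linarith
        -- The point (R + 1) • e lies in the connected exterior, so f has its value there
        -- throughout.
        obtain ⟨C, hC⟩ := jumpIntegral_le_of_const hγ hR1 (f := f) (b := f ((R + 1) • e))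
          (fun x hx => eq_of_gradient_eq_zero hf hopen
            (isPreconnected_exterior hn2 (by linarith)) hR hx hmem)
        exact hN.tendsto_bvyFunctional_of_decay hn hp0 hγ hq hY hM he hf hs hR1 hR hdecay hC
      · obtain ⟨C, hC⟩ := jumpIntegral_le_of_gradient hn hγ hf hR1 hR
        -- Here a = -γ and n = 1, so the decay condition 1/p < -γ/q is the extra assumption q < -pγ.
        refine hN.tendsto_bvyFunctional_of_decay hn hp0 hγ hq hY hM he hf hs hR1 hR ?_ hC
        rw [div_lt_div_iff₀ hp0 hq, Nat.cast_one]
        linarith
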